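/- Let $\mathcal H$ be a complex Hilbert space, let $A\ge 1$ be a self-adjoint operator on $\mathcal H$ with quadratic form domain $Q(A)$ and dual $Q(A)^*$ ($Q(A)\subset\mathcal H\subset Q(A)^*$), and let $\{H(t)\}_{t\in[0,1)}$ be a family of symmetric (Hermitian sesquilinear) forms on $Q(A)$. Let $C>0$ and assume the following. (a) There is a self-adjoint operator $B\ge 0$ which commutes with $A$ (i.e. their resolvents commute), whose form domain satisfies $Q(A)\subset Q(B)$, and such that for all $t\in[0,1)$ $$C^{-1}A-CB\le H(t)\le CA,\qquad i[H(t),B]\le CA .$$ The first inequalities are inequalities of quadratic forms on $Q(A)$. The second one means $$i\big(\langle x,H(t)Bx\rangle-\langle Bx,H(t)x\rangle\big)\le C\langle x,Ax\rangle$$ for all $x\in Q(A)\cap D(B)$ with $Bx\in Q(A)$. (b) For every $x\in Q(A)$ the function $t\mapsto\langle x,H(t)x\rangle$ is differentiable on $[0,1)$ (from the right at $t=0$) and $$-C\langle x,Ax\rangle\le\frac{d}{dt}\langle x,H(t)x\rangle\le C\langle x,Ax\rangle .$$ Then for every $x_0\in Q(A)$ there is a unique $x\in L^\infty(0,1;Q(A))$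 such that $t\mapsto x(t)$ is continuous from $[0,1)$ to $\mathcal H$, $x(0)=x_0$, and $$i\dot x(t)=H(t)x(t)\quad\text{in } Q(A)^* ,$$ where the time derivative is taken in the sense of $Q(A)^*$-valued distributions on $(0,1)$. Moreover, for all $t\in[0,1)$ we have $\|x(t)\|=\|x_0\|$, $x(t)\in Q(A)$ and $$\langle x(t),Ax(t)\rangle\le Ke^{Kt}\big(\langle x_0,Ax_0\rangle+K\big),$$ where the constant $K>0$ depends only on $C$ and on the relative form bound $\beta=\sup\{\langle x,Bx\rangle: x\in Q(A),\ \langle x,Ax\rangle\le 1\}$ (which is finite because $Q(A)\subset Q(B)$). -/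

import Mathlib

open Filter Topology MeasureTheory Set
open scoped ComplexConjugate ContDiff

/-- A (possibly unbounded) positive self-adjoint operator on a complex Hilbert space. -/
structure PosSelfAdjoint (E : Type*) [NormedAddCommGroup E] [InnerProductSpace ℂ E]
    [CompleteSpace E] where
  /-- the underlying partially defined operator -/
  op : E →ₗ.[ℂ] E
  isSelfAdjoint : IsSelfAdjoint op
  nonneg : ∀ x : op.domain, 0 ≤ (inner ℂ (x : E) (op x)).re

namespace PosSelfAdjoint

variable {E : Type*} [NormedAddCommGroup E] [InnerProductSpace ℂ E] [CompleteSpace E]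

/-- The expectation value `⟨x, T x⟩` for `x` in the operator domain. -/
noncomputable def energy (T : PosSelfAdjoint E) (x : T.op.domain) : ℝ :=
  (inner ℂ (x : E) (T.op x)).re

/-- `u` is a sequence in the operator domain which converges to `x` in the Hilbert space and is
Cauchy for the form norm of `T`. -/
def IsFormApprox (T : PosSelfAdjoint E) (x : E) (u : ℕ → T.op.domain) : Prop :=
  Tendsto (fun n => (u n : E)) atTop (𝓝 x) ∧
    Tendsto (fun p : ℕ × ℕ => T.energy (u p.1 - u p.2)) atTop (𝓝 0)

theorem energy_add_le (T : PosSelfAdjoint E) (x y : T.op.domain) :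
    T.energy (x + y) ≤ 2 * T.energy x + 2 * T.energy y := by
  have h := T.nonneg (x - y)
  simp only [energy, LinearPMap.map_add, LinearPMap.map_sub, Submodule.coe_add, Submodule.coe_sub,
    inner_add_left, inner_add_right, inner_sub_left, inner_sub_right, Complex.add_re,
    Complex.sub_re] at h ⊢
  linarith

theorem energy_smul (T : PosSelfAdjoint E) (c : ℂ) (x : T.op.domain) :
    T.energy (c • x) = ‖c‖ ^ 2 * T.energy x := by
  simp only [energy, LinearPMap.map_smul, Submodule.coe_smul, inner_smul_left, inner_smul_right]
  rw [← mul_assoc, Complex.mul_conj, Complex.re_ofReal_mul, Complex.normSq_eq_norm_sq]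

/-- The quadratic form domain `Q(T)`: the completion of the operator domain in the form norm,
realised inside the Hilbert space. -/
def formDomain (T : PosSelfAdjoint E) : Submodule ℂ E where
  carrier := {x | ∃ u, T.IsFormApprox x u}
  zero_mem' := ⟨fun _ => 0, by simp [IsFormApprox, energy]⟩
  add_mem' := by
    rintro x y ⟨u, hu, hu'⟩ ⟨v, hv, hv'⟩
    refine ⟨fun n => u n + v n, by simpa using hu.add hv, ?_⟩
    refine squeeze_zero (fun _ => T.nonneg _) (fun p => ?_)
      (by simpa using (hu'.const_mul 2).add (hv'.const_mul 2))
    have := T.energy_add_le (u p.1 - u p.2) (v p.1 - v p.2)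
    rwa [← add_sub_add_comm] at this
  smul_mem' := by
    rintro c x ⟨u, hu, hu'⟩
    refine ⟨fun n => c • u n, by simpa using hu.const_smul c, ?_⟩
    simp only [← smul_sub, energy_smul]
    simpa using hu'.const_mul (‖c‖ ^ 2)

/-- The closed quadratic form `x ↦ ⟨x, T x⟩` on `Q(T)`: the limit of `⟨uₙ, T uₙ⟩` along
approximating sequences (see `tendsto_form` for the independence of the sequence). -/
noncomputable def form (T : PosSelfAdjoint E) (x : T.formDomain) : ℝ :=
  limUnder atTop fun n => T.energy (Classical.choose x.2 n)

theorem inner_symm' (T : PosSelfAdjoint E) (x y : T.op.domain) :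
    (inner ℂ (x : E) (T.op y)).re = (inner ℂ (y : E) (T.op x)).re := by
  have h := LinearPMap.adjoint_isFormalAdjoint (T := T.op) T.isSelfAdjoint.dense_domain
  rw [LinearPMap.isSelfAdjoint_def.mp T.isSelfAdjoint] at h
  rw [← h x y, ← inner_conj_symm, Complex.conj_re]

theorem sqrt_energy_add_le (T : PosSelfAdjoint E) (x y : T.op.domain) :
    √(T.energy (x + y)) ≤ √(T.energy x) + √(T.energy y) := by
  have hx : 0 ≤ T.energy x := T.nonneg x
  have hy : 0 ≤ T.energy y := T.nonneg y
  set c := (inner ℂ (x : E) (T.op y)).re with hc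
  have key : ∀ s : ℝ, T.energy (x + (s : ℂ) • y) =
      T.energy y * (s * s) + 2 * c * s + T.energy x := by
    intro s
    have h := T.inner_symm' x y
    simp only [energy, LinearPMap.map_add, LinearPMap.map_smul, Submodule.coe_add,
      Submodule.coe_smul, inner_add_left, inner_add_right, inner_smul_left, inner_smul_right,
      Complex.add_re, Complex.conj_ofReal, Complex.re_ofReal_mul, ← h]
    ring
  have hd := discrim_le_zero (a := T.energy y) (b := 2 * c) (c := T.energy x)
    (fun s => by rw [← key]; exact T.nonneg _)
  have h1 := key 1
  simp only [Complex.ofReal_one, one_smul] at h1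
  have hcs : c ≤ √(T.energy x) * √(T.energy y) := by
    rw [← Real.sqrt_mul hx]
    refine Real.le_sqrt_of_sq_le ?_
    unfold discrim at hd
    linarith
  rw [Real.sqrt_le_iff]
  refine ⟨by positivity, ?_⟩
  rw [h1, add_sq, Real.sq_sqrt hx, Real.sq_sqrt hy]
  linarith

theorem abs_sqrt_energy_sub_le (T : PosSelfAdjoint E) (x y : T.op.domain) :
    |√(T.energy x) - √(T.energy y)| ≤ √(T.energy (x - y)) := by
  have h1 := T.sqrt_energy_add_le (x - y) y
  have h2 := T.sqrt_energy_add_le (y - x) x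
  have h3 : T.energy (y - x) = T.energy (x - y) := by
    have := T.energy_smul (-1) (x - y)
    simpa using this
  rw [sub_add_cancel] at h1 h2
  rw [h3] at h2
  rw [abs_le]
  constructor <;> linarith

theorem tendsto_energy_zero (T : PosSelfAdjoint E) {w : ℕ → T.op.domain}
    (hw : T.IsFormApprox 0 w) : Tendsto (fun n => T.energy (w n)) atTop (𝓝 0) := by
  rw [Metric.tendsto_atTop]
  intro ε hε
  obtain ⟨N, hN⟩ := Metric.tendsto_atTop.mp hw.2 (ε / 2) (half_pos hε)
  refine ⟨max N.1 N.2, fun m hm => ?_⟩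
  have hm1 : N.1 ≤ m := (le_max_left _ _).trans hm
  have hm2 : N.2 ≤ m := (le_max_right _ _).trans hm
  have hlim : Tendsto (fun n => ε / 2 + 2 * (inner ℂ (w n : E) (T.op (w m))).re) atTop
      (𝓝 (ε / 2)) := by
    have h := (Complex.continuous_re.tendsto _).comp
      (hw.1.inner (𝕜 := ℂ) (tendsto_const_nhds (x := T.op (w m))))
    simp only [inner_zero_left, Complex.zero_re] at h
    simpa using (h.const_mul 2).const_add (ε / 2)
  have hle : T.energy (w m) ≤ ε / 2 := by
    refine ge_of_tendsto hlim ?_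
    filter_upwards [eventually_ge_atTop N.1] with n hn
    have h1 := hN (n, m) ⟨hn, hm2⟩
    have h2 := T.inner_symm' (w n) (w m)
    have h3 := T.nonneg (w n)
    rw [Real.dist_0_eq_abs] at h1
    have h4 := (abs_lt.mp h1).2
    simp only [energy, LinearPMap.map_sub, Submodule.coe_sub, inner_sub_left, inner_sub_right,
      Complex.sub_re] at h4 ⊢
    linarith
  have h0 : 0 ≤ T.energy (w m) := T.nonneg _
  rw [Real.dist_0_eq_abs, abs_of_nonneg h0]
  linarith

/-- The value of the form is the limit of the energies along every approximating sequence. -/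
theorem tendsto_form (T : PosSelfAdjoint E) (x : T.formDomain) {u : ℕ → T.op.domain}
    (hu : T.IsFormApprox x u) : Tendsto (fun n => T.energy (u n)) atTop (𝓝 (T.form x)) := by
  have hv := Classical.choose_spec x.2
  set v := Classical.choose x.2 with hvdef
  have hcauchy : CauchySeq fun n => √(T.energy (v n)) := by
    rw [cauchySeq_iff_tendsto_dist_atTop_0]
    refine squeeze_zero (fun _ => dist_nonneg) (fun p => ?_)
      (by simpa using (Real.continuous_sqrt.tendsto 0).comp hv.2)
    exact T.abs_sqrt_energy_sub_le _ _
  obtain ⟨l, hl⟩ := cauchySeq_tendsto_of_complete hcauchy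
  have hsq : ∀ y : T.op.domain, √(T.energy y) ^ 2 = T.energy y :=
    fun y => Real.sq_sqrt (T.nonneg y)
  have hform : T.form x = l ^ 2 := by
    refine Tendsto.limUnder_eq ?_
    simpa only [hsq] using hl.pow 2
  have hdiff : T.IsFormApprox 0 (fun n => u n - v n) := by
    refine ⟨by simpa using hu.1.sub hv.1, ?_⟩
    refine squeeze_zero (fun _ => T.nonneg _) (fun p => ?_)
      (by simpa using (hu.2.const_mul 2).add (hv.2.const_mul 2))
    have h := T.energy_add_le (u p.1 - u p.2) (-(v p.1 - v p.2))
    have h3 : T.energy (-(v p.1 - v p.2)) = T.energy (v p.1 - v p.2) := by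
      simpa using T.energy_smul (-1) (v p.1 - v p.2)
    have h4 : u p.1 - v p.1 - (u p.2 - v p.2) = u p.1 - u p.2 + -(v p.1 - v p.2) := by abel
    simp only [h4]
    rwa [h3] at h
  have h0 : Tendsto (fun n => √(T.energy (u n - v n))) atTop (𝓝 0) := by
    simpa using (T.tendsto_energy_zero hdiff).sqrt
  have h1 : Tendsto (fun n => √(T.energy (u n)) - √(T.energy (v n))) atTop (𝓝 0) :=
    squeeze_zero_norm (fun n => T.abs_sqrt_energy_sub_le _ _) h0
  have h2 : Tendsto (fun n => √(T.energy (u n))) atTop (𝓝 l) := by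
    simpa using h1.add hl
  rw [hform]
  simpa only [hsq] using h2.pow 2

/-- The bounded operator `R` is the resolvent `(T + 1)⁻¹`. -/
def IsResolvent (T : PosSelfAdjoint E) (R : E →L[ℂ] E) : Prop :=
  (∀ x : E, ∃ h : R x ∈ T.op.domain, T.op ⟨R x, h⟩ + R x = x) ∧
    ∀ x : T.op.domain, R (T.op x + x) = x

/-- Two positive self-adjoint operators commute (in the strong sense): their resolvents, which
exist because `-1` is not in the spectrum of a positive operator, commute. -/
def StronglyCommute (S T : PosSelfAdjoint E) : Prop :=
  ∃ R R' : E →L[ℂ] E, S.IsResolvent R ∧ T.IsResolvent R' ∧ Commute R R'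

/-- The relative form bound of `B` with respect to `A`: the least `β ≥ 0` with `B ≤ β A` on
`Q(A)`. It is finite for `A ≥ 1` and `Q(A) ⊆ Q(B)`, by the closed graph theorem. -/
noncomputable def relFormBound (A B : PosSelfAdjoint E) (hQ : A.formDomain ≤ B.formDomain) : ℝ :=
  sSup {r | ∃ x : A.formDomain, A.form x ≤ 1 ∧ r = B.form (Submodule.inclusion hQ x)}

/-- `x : [0, 1) → E` is a solution of `i ẋ(t) = H(t) x(t)` in `Q(A)*`, `x(0) = x₀`, in the class
`L^∞(0, 1; Q(A)) ∩ C⁰([0, 1); E)`. Here `H t` are sesquilinear forms on `Q(A)`, conjugate linear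
in the first argument, `z` is the `Q(A)`-valued representative of `x`, and the time derivative is
the distributional one: for all `φ ∈ C_c^∞(0, 1)` one has
`-∫ φ'(t) i x(t) dt = ∫ φ(t) H(t) x(t) dt` as functionals on `Q(A)`. -/
structure IsSolution (A : PosSelfAdjoint E)
    (H : ℝ → A.formDomain →ₗ⋆[ℂ] A.formDomain →ₗ[ℂ] ℂ) (x₀ : A.formDomain) (x : ℝ → E) :
    Prop where
  continuousOn : ContinuousOn x (Ico 0 1)
  initial : x 0 = x₀
  equation : ∃ z : ℝ → A.formDomain,
    (∀ᵐ t ∂(volume.restrict (Ioo (0 : ℝ) 1)), (z t : E) = x t) ∧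
    (∃ M : ℝ, ∀ᵐ t ∂(volume.restrict (Ioo (0 : ℝ) 1)), A.form (z t) ≤ M) ∧
    ∀ (y : A.formDomain) (φ : ℝ → ℝ), ContDiff ℝ ∞ φ → HasCompactSupport φ →
      tsupport φ ⊆ Ioo 0 1 →
      -∫ t in Ioo (0 : ℝ) 1, ((deriv φ t : ℝ) : ℂ) * (Complex.I * inner ℂ (y : E) (z t : E)) =
        ∫ t in Ioo (0 : ℝ) 1, (φ t : ℂ) * H t y (z t)

end PosSelfAdjoint

/-!
Write `ρ = (A + 1)^(-1/2)` and `S = (B + 1)⁻¹`. In the coordinate `w`, where `x = ρ w`, the forms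
`H(t)` become bounded self-adjoint operators `k(t)`, Lipschitz in `t`, and the equation becomes
`i ρ² ẇ = k(t) w`. Its energy cannot be estimated by differentiating `H(t)` alone, because `H(t)` is
only bounded below modulo `B`; but `⟨x, (H(t) + C B) x⟩` is comparable to `⟨x, A x⟩`, and along a
solution its derivative is `⟨x, Ḣ(t) x⟩` plus a commutator of `H(t)` with `B`, both controlled by
`A`. Grönwall's inequality then gives the exponential bound.

To have solutions for which this computation is legitimate, compress `k(t)` by the regularized
inverses `N = S M`, with `M = ρ S ((ρ S)² + ε)⁻¹`. They commute with `ρ` and `S`, map into the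
domain of `B`, and `ρ N` tends strongly to `1`, so the regularized generators are bounded while the
commutator estimate survives uniformly in `ε`. A weak limit as `ε → 0` is a solution obeying the
same bound. Uniqueness is conservation of the norm, applied to the difference of two solutions: a
bounded weak solution is differentiable after pairing with `ran ρ²`, and this is enough to show that
`‖x(t)‖` is constant.
-/

section BoundedOperators

variable {E : Type*} [NormedAddCommGroup E] [InnerProductSpace ℂ E]

theorem re_inner_self_eq_norm_sq (x : E) : (inner ℂ x x).re = ‖x‖ ^ 2 :=
  inner_self_eq_norm_sq (𝕜 := ℂ) x

theorem tendsto_apply_of_opNorm_le_of_dense {ι 𝕜 F G : Type*} [NontriviallyNormedField 𝕜]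
    [NormedAddCommGroup F] [NormedSpace 𝕜 F] [NormedAddCommGroup G] [NormedSpace 𝕜 G]
    {l : Filter ι} {T : ι → F →L[𝕜] G} {T₀ : F →L[𝕜] G} {M : ℝ} (hM : ∀ᶠ i in l, ‖T i‖ ≤ M)
    {D : Set F} (hD : Dense D) (hT : ∀ y ∈ D, Tendsto (fun i => T i y) l (𝓝 (T₀ y))) (x : F) :
    Tendsto (fun i => T i x) l (𝓝 (T₀ x)) := by
  rw [Metric.tendsto_nhds]
  intro ε hε
  set K := |M| + ‖T₀‖ + 1
  have : 0 < K := by positivity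
  obtain ⟨y, hyD, hy⟩ := hD.exists_dist_lt x (show 0 < ε / (2 * K) by positivity)
  rw [lt_div_iff₀ (by positivity), dist_eq_norm] at hy
  filter_upwards [hM, Metric.tendsto_nhds.mp (hT y hyD) (ε / 2) (by positivity)] with i hi hiy
  have hnorm : ‖T i - T₀‖ ≤ K := by
    linarith [norm_sub_le (T i) T₀, le_abs_self M]
  calc dist (T i x) (T₀ x) = ‖(T i - T₀) (x - y) + (T i y - T₀ y)‖ := by
        rw [dist_eq_norm, map_sub, sub_apply, sub_apply]
        congr 1
        abel
    _ ≤ ‖(T i - T₀) (x - y)‖ + dist (T i y) (T₀ y) := by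
        rw [dist_eq_norm]
        exact norm_add_le _ _
    _ ≤ K * ‖x - y‖ + dist (T i y) (T₀ y) := by
        gcongr
        exact ContinuousLinearMap.le_of_opNorm_le _ hnorm _
    _ < ε := by linarith

variable [CompleteSpace E]

theorem denseRange_of_isSelfAdjoint_of_injective {T : E →L[ℂ] E} (hT : IsSelfAdjoint T)
    (hinj : Function.Injective T) : DenseRange T := by
  have hker : LinearMap.ker (T : E →ₗ[ℂ] E) = ⊥ := LinearMap.ker_eq_bot.mpr hinj
  have hdense := Submodule.topologicalClosure_eq_top_iff.mpr
    (T.orthogonal_range.trans (by rw [hT.adjoint_eq, hker]))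
  exact Submodule.dense_iff_topologicalClosure_eq_top.mpr hdense

theorem nonneg_of_isSelfAdjoint_of_re_inner_nonneg {T : E →L[ℂ] E} (hT : IsSelfAdjoint T)
    (hpos : ∀ x, 0 ≤ (inner ℂ x (T x)).re) : 0 ≤ T := by
  rw [ContinuousLinearMap.nonneg_iff_isPositive, ContinuousLinearMap.isPositive_def']
  exact ⟨hT, fun x => (hpos x).trans_eq (congrArg Complex.re (hT.isSymmetric x x).symm)⟩

theorem norm_sqrt_apply_sq {T : E →L[ℂ] E} (hT : 0 ≤ T) (x : E) :
    ‖CFC.sqrt T x‖ ^ 2 = (inner ℂ x (T x)).re := by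
  have hsymm := (CFC.sqrt_nonneg T).isSelfAdjoint.isSymmetric x (CFC.sqrt T x)
  rw [← re_inner_self_eq_norm_sq]
  conv_rhs => rw [← CFC.sqrt_mul_sqrt_self T hT]
  exact congrArg Complex.re hsymm

theorem commute_sqrt {T X : E →L[ℂ] E} (h : Commute T X) : Commute (CFC.sqrt T) X := by
  rw [CFC.sqrt_eq_cfc]
  exact h.cfc_nnreal _

theorem re_inner_apply_le_of_commute {T J : E →L[ℂ] E} (hT : 0 ≤ T) (hTJ : Commute T J)
    (hJ : ‖J‖ ≤ 1) (x : E) : (inner ℂ (J x) (T (J x))).re ≤ (inner ℂ x (T x)).re := by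
  have hcomm : CFC.sqrt T (J x) = J (CFC.sqrt T x) := DFunLike.congr_fun (commute_sqrt hTJ).eq x
  rw [← norm_sqrt_apply_sq hT, ← norm_sqrt_apply_sq hT, hcomm]
  gcongr
  simpa using J.le_of_opNorm_le hJ (CFC.sqrt T x)

theorem exists_weak_limit {ι : Type*} (U : Ultrafilter ι) {x : ι → E} {M : ℝ}
    (hx : ∀ᶠ i in (U : Filter ι), ‖x i‖ ≤ M) :
    ∃ x' : E, ‖x'‖ ≤ M ∧ ∀ y, Tendsto (fun i => inner ℂ y (x i)) U (𝓝 (inner ℂ y x')) := by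
  let f : ι → WeakDual ℂ E := fun i => StrongDual.toWeakDual (InnerProductSpace.toDual ℂ E (x i))
  have hf : ∀ᶠ i in (U : Filter ι),
      f i ∈ WeakDual.toStrongDual ⁻¹' Metric.closedBall (0 : StrongDual ℂ E) M := by
    filter_upwards [hx] with i hi
    have : ‖InnerProductSpace.toDual ℂ E (x i)‖ ≤ M := by rwa [LinearIsometryEquiv.norm_map]
    simpa [f] using this
  obtain ⟨g, hg, hlim⟩ := (WeakDual.isCompact_closedBall (𝕜 := ℂ) (E := E) 0 M).ultrafilter_le_nhds
    (U.map f) (tendsto_principal.mpr hf)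
  refine ⟨(InnerProductSpace.toDual ℂ E).symm (WeakDual.toStrongDual g), ?_, fun y => ?_⟩
  · rw [LinearIsometryEquiv.norm_map]
    simpa using hg
  · have heval : Tendsto (fun i => f i y) U (𝓝 (g y)) :=
      ((WeakDual.eval_continuous y).tendsto g).comp hlim
    rw [← inner_conj_symm, InnerProductSpace.toDual_symm_apply]
    refine ((Complex.continuous_conj.tendsto _).comp heval).congr fun i => ?_
    simp [f]

/-- The Tikhonov regularization `T (T² + ε)⁻¹` of the inverse of a self-adjoint operator `T`. -/
noncomputable def tikhonovInverse (T : E →L[ℂ] E) (ε : ℝ) : E →L[ℂ] E :=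
  cfc (fun r : ℝ => r / (r ^ 2 + ε)) T

theorem isSelfAdjoint_tikhonovInverse (T : E →L[ℂ] E) (ε : ℝ) :
    IsSelfAdjoint (tikhonovInverse T ε) :=
  cfc_predicate _ _

theorem commute_tikhonovInverse {T X : E →L[ℂ] E} (h : Commute T X) (ε : ℝ) :
    Commute (tikhonovInverse T ε) X :=
  h.cfc_real _

theorem abs_mul_div_sq_add_mul_sub_le {ε : ℝ} (hε : 0 < ε) (r : ℝ) :
    |r * (r / (r ^ 2 + ε)) * r - r| ≤ √ε := by
  have hpos : 0 < r ^ 2 + ε := by positivity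
  have hsq : √ε * √ε = ε := Real.mul_self_sqrt hε.le
  have amgm : |r| * √ε ≤ r ^ 2 + ε := by
    nlinarith [sq_nonneg (|r| - √ε), sq_abs r, Real.sqrt_nonneg ε, abs_nonneg r]
  rw [show r * (r / (r ^ 2 + ε)) * r - r = -(r * ε) / (r ^ 2 + ε) by field_simp; ring,
    abs_div, abs_of_pos hpos, div_le_iff₀ hpos, abs_neg, abs_mul, abs_of_pos hε]
  calc |r| * ε = √ε * (|r| * √ε) := by rw [mul_left_comm, hsq]
    _ ≤ √ε * (r ^ 2 + ε) := by gcongr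

variable {T : E →L[ℂ] E}

theorem continuous_div_sq_add {ε : ℝ} (hε : 0 < ε) : Continuous fun r : ℝ => r / (r ^ 2 + ε) :=
  continuous_id.div (by fun_prop) fun r => (show 0 < r ^ 2 + ε by positivity).ne'

theorem mul_tikhonovInverse (hT : IsSelfAdjoint T) {ε : ℝ} (hε : 0 < ε) :
    T * tikhonovInverse T ε = cfc (fun r : ℝ => r * (r / (r ^ 2 + ε))) T := by
  rw [tikhonovInverse, cfc_mul (fun r : ℝ => r) _ T continuousOn_id
    (continuous_div_sq_add hε).continuousOn, cfc_id' ℝ T]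

theorem norm_mul_tikhonovInverse_le (hT : IsSelfAdjoint T) {ε : ℝ} (hε : 0 < ε) :
    ‖T * tikhonovInverse T ε‖ ≤ 1 := by
  rw [mul_tikhonovInverse hT hε]
  refine norm_cfc_le zero_le_one fun r _ => ?_
  rw [← mul_div_assoc, ← sq, Real.norm_of_nonneg (by positivity)]
  exact div_le_one_of_le₀ (by linarith) (by positivity)

theorem norm_mul_tikhonovInverse_mul_sub_le (hT : IsSelfAdjoint T) {ε : ℝ} (hε : 0 < ε) :
    ‖T * tikhonovInverse T ε * T - T‖ ≤ √ε := by
  have hcont := continuous_div_sq_add hε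
  have hcfc : T * tikhonovInverse T ε * T - T =
      cfc (fun r : ℝ => r * (r / (r ^ 2 + ε)) * r - r) T := by
    rw [mul_tikhonovInverse hT hε, cfc_sub (fun r : ℝ => r * (r / (r ^ 2 + ε)) * r) (fun r => r) T
      (by fun_prop) (by fun_prop), cfc_mul (fun r : ℝ => r * (r / (r ^ 2 + ε))) (fun r => r) T
      (by fun_prop) (by fun_prop), cfc_id' ℝ T]
  rw [hcfc]
  exact norm_cfc_le (Real.sqrt_nonneg _) fun r _ => abs_mul_div_sq_add_mul_sub_le hε r

theorem tendsto_mul_tikhonovInverse_apply (hT : IsSelfAdjoint T) (hinj : Function.Injective T)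
    (x : E) : Tendsto (fun ε => (T * tikhonovInverse T ε) x) (𝓝[>] 0) (𝓝 x) := by
  have hbound : ∀ᶠ ε in 𝓝[>] (0 : ℝ), ‖T * tikhonovInverse T ε‖ ≤ 1 := by
    filter_upwards [self_mem_nhdsWithin] with ε hε using norm_mul_tikhonovInverse_le hT hε
  refine tendsto_apply_of_opNorm_le_of_dense (T₀ := 1) hbound
    (denseRange_of_isSelfAdjoint_of_injective hT hinj) ?_ x
  rintro _ ⟨y, rfl⟩
  have hsqrt : Tendsto (fun ε : ℝ => √ε * ‖y‖) (𝓝[>] 0) (𝓝 0) := by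
    have : Continuous fun ε : ℝ => √ε * ‖y‖ := by fun_prop
    simpa using (this.tendsto 0).mono_left nhdsWithin_le_nhds
  refine tendsto_iff_norm_sub_tendsto_zero.mpr (squeeze_zero' (Eventually.of_forall fun _ =>
    norm_nonneg _) ?_ hsqrt)
  filter_upwards [self_mem_nhdsWithin] with ε hε
  exact ContinuousLinearMap.le_of_opNorm_le _ (norm_mul_tikhonovInverse_mul_sub_le hT hε) y

end BoundedOperators

section Calculus

section RadialRetraction

theorem abs_div_max_le_one {r : ℝ} (hr : 0 < r) (s : ℝ) : |r / max r s| ≤ 1 := by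
  have hmax : 0 < max r s := lt_max_of_lt_left hr
  rw [abs_of_pos (div_pos hr hmax)]
  exact (div_le_one hmax).mpr (le_max_left _ _)

variable {E : Type*} [NormedAddCommGroup E] [NormedSpace ℝ E] {r : ℝ}

/-- The radial retraction of a normed space onto the closed ball of radius `r > 0` about `0`. -/
noncomputable def radialRetraction (r : ℝ) (x : E) : E := (r / max r ‖x‖) • x

theorem norm_radialRetraction_le_norm (hr : 0 < r) (x : E) : ‖radialRetraction r x‖ ≤ ‖x‖ := by
  rw [radialRetraction, norm_smul]
  exact mul_le_of_le_one_left (norm_nonneg _) (abs_div_max_le_one hr _)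

theorem norm_radialRetraction_le (hr : 0 < r) (x : E) : ‖radialRetraction r x‖ ≤ r := by
  have hmax : 0 < max r ‖x‖ := lt_max_of_lt_left hr
  rw [radialRetraction, norm_smul, Real.norm_of_nonneg (by positivity), div_mul_eq_mul_div,
    div_le_iff₀ hmax]
  gcongr
  exact le_max_right _ _

theorem radialRetraction_of_norm_le (hr : 0 < r) {x : E} (hx : ‖x‖ ≤ r) :
    radialRetraction r x = x := by
  rw [radialRetraction, max_eq_left hx, div_self hr.ne', one_smul]

theorem lipschitzWith_radialRetraction (hr : 0 < r) :
    LipschitzWith 2 (radialRetraction r : E → E) := by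
  refine LipschitzWith.of_dist_le_mul fun x y => ?_
  have : 0 < max r ‖x‖ := lt_max_of_lt_left hr
  have hy : 0 < max r ‖y‖ := lt_max_of_lt_left hr
  have hmax : |max r ‖y‖ - max r ‖x‖| ≤ ‖x - y‖ := by
    refine (abs_max_sub_max_le_max _ _ _ _).trans ?_
    rw [sub_self, abs_zero, norm_sub_rev]
    exact max_le (norm_nonneg _) (abs_norm_sub_norm_le _ _)
  have hcoef : ‖(r / max r ‖x‖ - r / max r ‖y‖) • y‖ ≤ ‖x - y‖ := by
    rw [show r / max r ‖x‖ - r / max r ‖y‖ =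
        r / max r ‖x‖ * ((max r ‖y‖ - max r ‖x‖) / max r ‖y‖) by field_simp, norm_smul,
      Real.norm_eq_abs, abs_mul, abs_div (_ - _), abs_of_pos hy]
    calc |r / max r ‖x‖| * (|max r ‖y‖ - max r ‖x‖| / max r ‖y‖) * ‖y‖
        = |r / max r ‖x‖| * |max r ‖y‖ - max r ‖x‖| * (‖y‖ / max r ‖y‖) := by ring
      _ ≤ 1 * ‖x - y‖ * 1 := by
          gcongr
          · exact abs_div_max_le_one hr _
          · exact (div_le_one hy).mpr (le_max_right _ _)
      _ = ‖x - y‖ := by ring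
  calc dist (radialRetraction r x) (radialRetraction r y)
      = ‖(r / max r ‖x‖) • (x - y) + (r / max r ‖x‖ - r / max r ‖y‖) • y‖ := by
        rw [dist_eq_norm, radialRetraction, radialRetraction, smul_sub, sub_smul]
        abel_nf
    _ ≤ ‖(r / max r ‖x‖) • (x - y)‖ + ‖(r / max r ‖x‖ - r / max r ‖y‖) • y‖ := norm_add_le _ _
    _ ≤ ‖x - y‖ + ‖x - y‖ := by
        gcongr
        rw [norm_smul]
        exact mul_le_of_le_one_left (norm_nonneg _) (abs_div_max_le_one hr _)
    _ = (2 : NNReal) * dist x y := by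
        rw [dist_eq_norm, NNReal.coe_ofNat]
        ring

end RadialRetraction

section LinearODE

variable {E : Type*} [NormedAddCommGroup E] [NormedSpace ℝ E] {a b Λ : ℝ}

theorem norm_le_mul_exp_of_norm_deriv_le {u u' : ℝ → E}
    (hu : ∀ t ∈ Icc a b, HasDerivWithinAt u (u' t) (Icc a b) t)
    (hbound : ∀ t ∈ Icc a b, ‖u' t‖ ≤ Λ * ‖u t‖) {t : ℝ} (ht : t ∈ Icc a b) :
    ‖u t‖ ≤ ‖u a‖ * Real.exp (Λ * (t - a)) := by
  rw [← gronwallBound_ε0]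
  refine norm_le_gronwallBound_of_norm_deriv_right_le (f' := u')
    (fun s hs => (hu s hs).continuousWithinAt) (fun s hs => ?_) le_rfl (fun s hs => ?_) t ht
  · exact (hu s (Ico_subset_Icc_self hs)).mono_of_mem_nhdsWithin (Icc_mem_nhdsGE_of_mem hs)
  · rw [add_zero]
    exact hbound s (Ico_subset_Icc_self hs)

theorem exists_hasDerivWithinAt_of_lipschitzWith_of_norm_le [CompleteSpace E] {K : NNReal}
    {f : ℝ → E → E} {M : ℝ} (hab : a ≤ b) (hf : ∀ t ∈ Icc a b, LipschitzWith K (f t))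
    (hc : ∀ x, ContinuousOn (fun t => f t x) (Icc a b)) (hM : ∀ t ∈ Icc a b, ∀ x, ‖f t x‖ ≤ M)
    (u₀ : E) :
    ∃ u : ℝ → E, u a = u₀ ∧ ∀ t ∈ Icc a b, HasDerivWithinAt u (f t (u t)) (Icc a b) t := by
  have hM' : ∀ t ∈ Icc a b, ∀ x, ‖f t x‖ ≤ M.toNNReal := fun t ht x =>
    (hM t ht x).trans (Real.le_coe_toNNReal M)
  have hPL : IsPicardLindelof f (⟨a, left_mem_Icc.mpr hab⟩ : Icc a b) u₀
      (M.toNNReal * (b - a).toNNReal) 0 M.toNNReal K := by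
    refine ⟨fun t ht => (hf t ht).lipschitzOnWith, fun x _ => hc x, fun t ht x _ => hM' t ht x, ?_⟩
    simp [sub_nonneg.mpr hab]
  exact hPL.exists_eq_forall_mem_Icc_hasDerivWithinAt₀

/- Picard–Lindelöf is applied to the equation cut off outside a ball which, by Grönwall's
inequality, the solution does not leave. -/
theorem exists_hasDerivWithinAt_clm_apply {𝕜 : Type*} [NontriviallyNormedField 𝕜]
    [NormedSpace 𝕜 E] [CompleteSpace E] {L : ℝ → E →L[𝕜] E} (hab : a ≤ b)
    (hL : ContinuousOn L (Icc a b)) (u₀ : E) :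
    ∃ u : ℝ → E, u a = u₀ ∧ ∀ t ∈ Icc a b, HasDerivWithinAt u (L t (u t)) (Icc a b) t := by
  obtain ⟨Λ, hΛ⟩ := isCompact_Icc.exists_bound_of_continuousOn hL
  have hΛ0 : 0 ≤ Λ := (norm_nonneg _).trans (hΛ a (left_mem_Icc.mpr hab))
  obtain ⟨r, hr, hur⟩ : ∃ r : ℝ, 0 < r ∧ ‖u₀‖ * Real.exp (Λ * (b - a)) ≤ r :=
    ⟨‖u₀‖ * Real.exp (Λ * (b - a)) + 1, by positivity, by linarith⟩
  obtain ⟨u, hu₀, hu⟩ := exists_hasDerivWithinAt_of_lipschitzWith_of_norm_le (K := Λ.toNNReal * 2)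
    (f := fun t x => L t (radialRetraction r x)) (M := Λ * r) hab
    (fun t ht => ((L t).lipschitz.weaken (NNReal.le_toNNReal_of_coe_le (hΛ t ht))).comp
      (lipschitzWith_radialRetraction hr))
    (fun x => hL.clm_apply continuousOn_const)
    (fun t ht x => ((L t).le_of_opNorm_le (hΛ t ht) _).trans
      (by gcongr; exact norm_radialRetraction_le hr x)) u₀
  have hnorm : ∀ t ∈ Icc a b, ‖u t‖ ≤ r := fun t ht => by
    have h := norm_le_mul_exp_of_norm_deriv_le (Λ := Λ) hu (fun s hs =>
      ((L s).le_of_opNorm_le (hΛ s hs) _).trans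
        (by gcongr; exact norm_radialRetraction_le_norm hr _)) ht
    rw [hu₀] at h
    refine h.trans (le_trans ?_ hur)
    gcongr
    exact ht.2
  refine ⟨u, hu₀, fun t ht => ?_⟩
  simpa only [radialRetraction_of_norm_le hr (hnorm t ht)] using hu t ht

end LinearODE

section LowerSupport

variable {f : ℝ → ℝ} {a b : ℝ}

theorem le_of_lower_support (hab : a ≤ b) (hf : ContinuousOn f (Icc a b))
    (h : ∀ t ∈ Ico a b, ∃ m : ℝ → ℝ, HasDerivWithinAt m 0 (Ioi t) t ∧ m t = f t ∧
      ∀ᶠ s in 𝓝[>] t, m s ≤ f s) : f a ≤ f b := by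
  have hslope : ∀ t ∈ Ico a b, ∀ r, 0 < r → ∃ᶠ s in 𝓝[>] t, slope (-f) t s < r := by
    intro t ht r hr
    obtain ⟨m, hm, hmt, hle⟩ := h t ht
    have hmr : ∀ᶠ s in 𝓝[>] t, -r < slope m t s :=
      ((hasDerivWithinAt_iff_tendsto_slope' self_notMem_Ioi).mp hm).eventually
        (lt_mem_nhds (by linarith))
    refine Eventually.frequently ?_
    filter_upwards [hmr, hle, self_mem_nhdsWithin] with s hs hms hts
    have hst : 0 < s - t := sub_pos.mpr hts
    rw [slope_def_field, lt_div_iff₀ hst] at hs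
    rw [slope_def_field, div_lt_iff₀ hst, Pi.neg_apply, Pi.neg_apply]
    linarith
  exact neg_le_neg_iff.mp (image_le_of_liminf_slope_right_le_deriv_boundary hf.neg
    (B := fun _ => -f a) le_rfl continuousOn_const (fun t _ => hasDerivWithinAt_const _ _ _)
    hslope (right_mem_Icc.mpr hab))

theorem eq_of_lower_support (hab : a ≤ b) (hf : ContinuousOn f (Icc a b))
    (h : ∀ t ∈ Icc a b, ∃ m : ℝ → ℝ, HasDerivAt m 0 t ∧ m t = f t ∧ ∀ s, m s ≤ f s) :
    f a = f b := by
  refine le_antisymm (le_of_lower_support hab hf fun t ht => ?_) ?_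
  · obtain ⟨m, hm, hmt, hle⟩ := h t (Ico_subset_Icc_self ht)
    exact ⟨m, hm.hasDerivWithinAt, hmt, Eventually.of_forall hle⟩
  · have hmaps : MapsTo (fun s => a + b - s) (Icc a b) (Icc a b) := fun s hs =>
      ⟨by linarith [hs.2], by linarith [hs.1]⟩
    have hreflect := le_of_lower_support (f := fun s => f (a + b - s)) hab
      (hf.comp (by fun_prop) hmaps) fun t ht => by
        obtain ⟨m, hm, hmt, hle⟩ := h (a + b - t) (hmaps (Ico_subset_Icc_self ht))
        refine ⟨fun s => m (a + b - s), ?_, hmt, Eventually.of_forall fun s => hle _⟩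
        simpa using (hm.comp_const_sub (a + b) t).hasDerivWithinAt
    simpa using hreflect

end LowerSupport

theorem continuousOn_extendFrom_closure {X Y : Type*} [UniformSpace X]
    [UniformSpace Y] [CompleteSpace Y] {f : X → Y} {s : Set X} (hf : UniformContinuousOn f s) :
    ContinuousOn (extendFrom s f) (closure s) := by
  refine continuousOn_extendFrom Subset.rfl fun x hx => ?_
  have : (𝓝[s] x).NeBot := mem_closure_iff_nhdsWithin_neBot.mp hx
  refine CompleteSpace.complete ⟨inferInstance, ?_⟩
  rw [prod_map_map_eq]
  refine Tendsto.mono_left hf (le_inf ?_ ?_)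
  · exact (cauchy_nhds.mono nhdsWithin_le_nhds).2
  · rw [← prod_principal_principal]
    exact Filter.prod_mono inf_le_right inf_le_right

section TestFunctions

theorem exists_subset_Icc_subset_Ioo {a b : ℝ} {K : Set ℝ} (hK : IsCompact K)
    (hKab : K ⊆ Ioo a b) : ∃ c d, K ⊆ Icc c d ∧ Icc c d ⊆ Ioo a b := by
  rcases K.eq_empty_or_nonempty with rfl | hne
  · exact ⟨1, 0, empty_subset _, by simp⟩
  · exact ⟨sInf K, sSup K, subset_Icc_csInf_csSup hK.bddBelow hK.bddAbove,
      Icc_subset_Ioo (hKab (hK.sInf_mem hne)).1 (hKab (hK.sSup_mem hne)).2⟩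

/-- `φ` is a real test function on the open set `U`: it is smooth and compactly supported
in `U`. -/
structure IsTestFunction (U : Set ℝ) (φ : ℝ → ℝ) : Prop where
  contDiff : ContDiff ℝ ∞ φ
  hasCompactSupport : HasCompactSupport φ
  tsupport_subset : tsupport φ ⊆ U

namespace IsTestFunction

variable {F : Type*} [NormedAddCommGroup F] [NormedSpace ℝ F] {U : Set ℝ} {φ χ : ℝ → ℝ}
  {g g' : ℝ → F}

theorem differentiable (hφ : IsTestFunction U φ) : Differentiable ℝ φ :=
  hφ.contDiff.differentiable (by simp)

theorem integrable (hφ : IsTestFunction U φ) : Integrable φ :=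
  hφ.contDiff.continuous.integrable_of_hasCompactSupport hφ.hasCompactSupport

theorem deriv (hφ : IsTestFunction U φ) : IsTestFunction U (_root_.deriv φ) where
  contDiff := (contDiff_infty_iff_deriv.mp hφ.contDiff).2
  hasCompactSupport := hφ.hasCompactSupport.deriv
  tsupport_subset := tsupport_deriv_subset.trans hφ.tsupport_subset

theorem sub_const_mul (hφ : IsTestFunction U φ) (hχ : IsTestFunction U χ) (c : ℝ) :
    IsTestFunction U fun t => φ t - c * χ t where
  contDiff := hφ.contDiff.sub (contDiff_const.mul hχ.contDiff)
  hasCompactSupport := hφ.hasCompactSupport.sub hχ.hasCompactSupport.mul_left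
  tsupport_subset := (tsupport_sub _ _).trans <| union_subset hφ.tsupport_subset <|
    (tsupport_mul_subset_right (f := fun _ => c)).trans hχ.tsupport_subset

theorem apply_eq_zero (hφ : IsTestFunction U φ) {t : ℝ} (ht : t ∉ U) : φ t = 0 :=
  image_eq_zero_of_notMem_tsupport fun h => ht (hφ.tsupport_subset h)

theorem integrable_smul (hφ : IsTestFunction U φ) (hU : IsOpen U) (hg : ContinuousOn g U) :
    Integrable fun t => φ t • g t :=
  ((hφ.contDiff.continuous.continuousOn.smul hg).continuous_of_tsupport_subset hU
    ((tsupport_smul_subset_left _ _).trans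
      hφ.tsupport_subset)).integrable_of_hasCompactSupport hφ.hasCompactSupport.smul_right

theorem setIntegral_smul (hφ : IsTestFunction U φ) (g : ℝ → F) :
    ∫ t in U, φ t • g t = ∫ t, φ t • g t :=
  setIntegral_eq_integral_of_forall_compl_eq_zero fun t ht => by
    rw [hφ.apply_eq_zero ht, zero_smul]

theorem integral_deriv_smul_eq_neg (hφ : IsTestFunction U φ) (hU : IsOpen U)
    (hg : ∀ t ∈ U, HasDerivAt g (g' t) t) (hg' : ContinuousOn g' U) :
    ∫ t, _root_.deriv φ t • g t = -∫ t, φ t • g' t := by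
  have hgc : ContinuousOn g U := fun t ht => (hg t ht).continuousAt.continuousWithinAt
  have hderiv : ∀ t, HasDerivAt (fun t => φ t • g t) (φ t • g' t + _root_.deriv φ t • g t) t := by
    intro t
    by_cases ht : t ∈ U
    · exact (hφ.differentiable t).hasDerivAt.smul (hg t ht)
    · rw [hφ.apply_eq_zero ht, hφ.deriv.apply_eq_zero ht, zero_smul, zero_smul, add_zero]
      refine (hasDerivAt_const t (0 : F)).congr_of_eventuallyEq ?_
      filter_upwards [notMem_tsupport_iff_eventuallyEq.mp fun h => ht (hφ.tsupport_subset h)]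
        with s hs
      rw [hs, Pi.zero_apply, zero_smul]
  have hint := hφ.integrable_smul hU hg'
  have hint' := hφ.deriv.integrable_smul hU hgc
  have hzero := integral_eq_zero_of_hasDerivAt_of_integrable hderiv (hint.add hint')
    (hφ.integrable_smul hU hgc)
  rw [integral_add hint hint'] at hzero
  exact eq_neg_of_add_eq_zero_right hzero

variable {a b : ℝ} {ψ : ℝ → ℝ}

theorem exists_integral_eq_one (hab : a < b) : ∃ η, IsTestFunction (Ioo a b) η ∧ ∫ t, η t = 1 := by
  let bump : ContDiffBump ((a + b) / 2) :=
    ⟨(b - a) / 8, (b - a) / 4, by linarith, by linarith⟩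
  refine ⟨bump.normed volume,
    ⟨bump.contDiff_normed, bump.hasCompactSupport_normed, ?_⟩, bump.integral_normed⟩
  rw [bump.tsupport_normed_eq, Real.closedBall_eq_Icc]
  rintro t ⟨hat, htb⟩
  simp only [bump] at hat htb
  constructor <;> linarith

theorem intervalIntegral_eq_zero (hψ : IsTestFunction (Ioo a b) ψ) (h0 : ∫ t, ψ t = 0)
    {c d : ℝ} (hcd : tsupport ψ ⊆ Icc c d) {t : ℝ} (ht : t ∉ Icc c d) : ∫ s in a..t, ψ s = 0 := by
  rcases lt_or_ge t c with htc | hct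
  · refine (intervalIntegral.integral_congr (g := fun _ => (0 : ℝ)) fun s hs => ?_).trans
      intervalIntegral.integral_zero
    refine image_eq_zero_of_notMem_tsupport fun hψs => not_le.mpr
      (max_lt (hψ.tsupport_subset hψs).1 (htc.trans_le (hcd hψs).1)) ?_
    exact (mem_uIcc.mp hs).elim (fun h => h.2.trans (le_max_right _ _))
      fun h => h.2.trans (le_max_left _ _)
  · have hdt : d < t := lt_of_not_ge fun h => ht ⟨hct, h⟩
    rw [intervalIntegral.integral_eq_integral_of_support_subset, h0]
    intro s hs
    exact ⟨(hψ.tsupport_subset (subset_tsupport ψ hs)).1,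
      (hcd (subset_tsupport ψ hs)).2.trans hdt.le⟩

theorem exists_deriv_eq (hψ : IsTestFunction (Ioo a b) ψ) (h0 : ∫ t, ψ t = 0) :
    ∃ φ, IsTestFunction (Ioo a b) φ ∧ _root_.deriv φ = ψ := by
  let φ : ℝ → ℝ := fun t => ∫ s in a..t, ψ s
  have hφψ : ∀ t, HasDerivAt φ (ψ t) t := fun t =>
    (hψ.contDiff.continuous.integral_hasStrictDerivAt a t).hasDerivAt
  have hderiv : _root_.deriv φ = ψ := funext fun t => (hφψ t).deriv
  obtain ⟨c, d, hcd, hIcc⟩ :=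
    exists_subset_Icc_subset_Ioo hψ.hasCompactSupport hψ.tsupport_subset
  have hsupp : tsupport φ ⊆ Icc c d :=
    closure_minimal (fun t ht => by_contra fun h => ht (hψ.intervalIntegral_eq_zero h0 hcd h))
      isClosed_Icc
  refine ⟨φ, ⟨?_, isCompact_Icc.of_isClosed_subset (isClosed_tsupport φ) hsupp,
    hsupp.trans hIcc⟩, hderiv⟩
  rw [contDiff_infty_iff_deriv, hderiv]
  exact ⟨fun t => (hφψ t).differentiableAt, hψ.contDiff⟩

end IsTestFunction

variable {F : Type*} [NormedAddCommGroup F] [NormedSpace ℝ F] [CompleteSpace F] {a b : ℝ}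
  {g g' : ℝ → F}

/- Du Bois-Reymond: every test function differs from a multiple of a fixed one of integral `1`
by the derivative of a test function. -/
theorem exists_eqOn_const_of_integral_deriv_smul_eq_zero (hab : a < b)
    (hg : ContinuousOn g (Ioo a b))
    (h : ∀ φ, IsTestFunction (Ioo a b) φ → ∫ t, deriv φ t • g t = 0) :
    ∃ c, EqOn g (fun _ => c) (Ioo a b) := by
  obtain ⟨η, hη, hη1⟩ := IsTestFunction.exists_integral_eq_one hab
  set c := ∫ t, η t • g t with hc
  have hae : ∀ᵐ t, t ∈ Ioo a b → g t - c = 0 := by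
    refine isOpen_Ioo.ae_eq_zero_of_integral_contDiff_smul_eq_zero
      ((hg.sub continuousOn_const).locallyIntegrableOn measurableSet_Ioo) fun χ hχ hχc hχs => ?_
    have hχ : IsTestFunction (Ioo a b) χ := ⟨hχ, hχc, hχs⟩
    set m := ∫ t, χ t with hm
    have hmean : ∫ t, (χ t - m * η t) = 0 := by
      rw [integral_sub hχ.integrable (hη.integrable.const_mul m), integral_const_mul, hη1,
        mul_one, sub_self]
    obtain ⟨φ, hφ, hφχ⟩ := (hχ.sub_const_mul hη m).exists_deriv_eq hmean
    have hφg := h φ hφ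
    simp only [hφχ, sub_smul, mul_smul] at hφg
    rw [integral_sub (hχ.integrable_smul isOpen_Ioo hg)
      ((hη.integrable_smul isOpen_Ioo hg).fun_smul m), integral_smul, ← hc] at hφg
    simp only [smul_sub]
    rw [integral_sub (hχ.integrable_smul isOpen_Ioo hg) (hχ.integrable.smul_const c),
      integral_smul_const, ← hm, hφg]
  refine ⟨c, Measure.eqOn_open_of_ae_eq (μ := volume) ?_ isOpen_Ioo hg continuousOn_const⟩
  rw [EventuallyEq, ae_restrict_iff' measurableSet_Ioo]
  filter_upwards [hae] with t ht htI using sub_eq_zero.mp (ht htI)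

theorem hasDerivAt_of_integral_deriv_smul_eq_neg (hg : ContinuousOn g (Ioo a b))
    (hg' : ContinuousOn g' (Ioo a b))
    (h : ∀ φ, IsTestFunction (Ioo a b) φ → ∫ t, deriv φ t • g t = -∫ t, φ t • g' t)
    {t : ℝ} (ht : t ∈ Ioo a b) : HasDerivAt g (g' t) t := by
  let P : ℝ → F := fun s => ∫ r in t..s, g' r
  have hP : ∀ s ∈ Ioo a b, HasDerivAt P (g' s) s := fun s hs =>
    intervalIntegral.integral_hasDerivAt_right
      (hg'.mono (ordConnected_Ioo.uIcc_subset ht hs)).intervalIntegrable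
      (hg'.stronglyMeasurableAtFilter isOpen_Ioo s hs)
      (hg'.continuousAt (isOpen_Ioo.mem_nhds hs))
  have hPc : ContinuousOn P (Ioo a b) := fun s hs => (hP s hs).continuousAt.continuousWithinAt
  obtain ⟨c, hc⟩ := exists_eqOn_const_of_integral_deriv_smul_eq_zero (ht.1.trans ht.2)
    (hg.sub hPc) fun φ hφ => by
      simp only [Pi.sub_apply, smul_sub]
      rw [integral_sub (hφ.deriv.integrable_smul isOpen_Ioo hg)
        (hφ.deriv.integrable_smul isOpen_Ioo hPc), h φ hφ,
        hφ.integral_deriv_smul_eq_neg isOpen_Ioo hP hg', sub_self]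
  refine ((hP t ht).const_add c).congr_of_eventuallyEq ?_
  filter_upwards [isOpen_Ioo.mem_nhds ht] with s hs
  exact sub_eq_iff_eq_add.mp (hc hs)

end TestFunctions

end Calculus

section SesquilinearForms

variable {E : Type*} [NormedAddCommGroup E] [InnerProductSpace ℂ E]
  {q : E →ₗ⋆[ℂ] E →ₗ[ℂ] ℂ} {c : ℝ}

theorem re_sesq_le_of_abs_re_self_le (hq : ∀ x y, q x y = conj (q y x))
    (hc : ∀ x, |(q x x).re| ≤ c * ‖x‖ ^ 2) (x y : E) :
    (q x y).re ≤ c / 2 * (‖x‖ ^ 2 + ‖y‖ ^ 2) := by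
  have hadd := (abs_le.mp (hc (x + y))).2
  have hsub := (abs_le.mp (hc (x - y))).1
  have hsymm : (q y x).re = (q x y).re := by rw [hq y x, Complex.conj_re]
  simp only [map_add, map_sub, LinearMap.add_apply, LinearMap.sub_apply, Complex.add_re,
    Complex.sub_re, hsymm] at hadd hsub
  linear_combination (hadd + hsub) / 4 + c / 4 * parallelogram_law_with_norm ℂ x y

theorem norm_sesq_le_half_of_abs_re_self_le (hq : ∀ x y, q x y = conj (q y x))
    (hc : ∀ x, |(q x x).re| ≤ c * ‖x‖ ^ 2) (x y : E) :
    ‖q x y‖ ≤ c / 2 * (‖x‖ ^ 2 + ‖y‖ ^ 2) := by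
  obtain ⟨phase, hphase, hnorm⟩ := RCLike.exists_norm_eq_mul_self (q x y)
  have h := re_sesq_le_of_abs_re_self_le hq hc x (phase • y)
  rw [map_smul, smul_eq_mul, ← hnorm, norm_smul, hphase, one_mul] at h
  exact_mod_cast h

theorem norm_sesq_le_of_abs_re_self_le (hq : ∀ x y, q x y = conj (q y x))
    (hc : ∀ x, |(q x x).re| ≤ c * ‖x‖ ^ 2) (x y : E) : ‖q x y‖ ≤ c * ‖x‖ * ‖y‖ := by
  rcases eq_or_ne x 0 with rfl | hx
  · simp
  rcases eq_or_ne y 0 with rfl | hy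
  · simp
  have hpos : 0 < ‖x‖ * ‖y‖ := mul_pos (norm_pos_iff.mpr hx) (norm_pos_iff.mpr hy)
  have h := norm_sesq_le_half_of_abs_re_self_le hq hc ((‖y‖ : ℂ) • x) ((‖x‖ : ℂ) • y)
  simp only [map_smul, LinearMap.map_smulₛₗ, LinearMap.smul_apply, norm_smul, Complex.conj_ofReal,
    Complex.norm_real, norm_norm] at h
  refine le_of_mul_le_mul_right ?_ hpos
  linear_combination h

theorem exists_isSelfAdjoint_of_sesq [CompleteSpace E] (hq : ∀ x y, q x y = conj (q y x))
    (hc : ∀ x, |(q x x).re| ≤ c * ‖x‖ ^ 2) :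
    ∃ T : E →L[ℂ] E, IsSelfAdjoint T ∧ ∀ x y, inner ℂ x (T y) = q x y := by
  let T := InnerProductSpace.continuousLinearMapOfBilin
    (q.mkContinuous₂ c (norm_sesq_le_of_abs_re_self_le hq hc))
  have hleft : ∀ x y, inner ℂ (T x) y = q x y := fun x y =>
    InnerProductSpace.continuousLinearMapOfBilin_apply _ x y
  have hright : ∀ x y, inner ℂ x (T y) = q x y := fun x y => by
    rw [← inner_conj_symm, hleft, ← hq]
  refine ⟨T, ?_, hright⟩
  rw [ContinuousLinearMap.isSelfAdjoint_iff_isSymmetric]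
  exact fun x y => (hleft x y).trans (hright x y).symm

theorem norm_le_of_abs_re_inner_self_le [CompleteSpace E] {T : E →L[ℂ] E} (hT : IsSelfAdjoint T)
    (hc0 : 0 ≤ c) (hc : ∀ x, |(inner ℂ x (T x)).re| ≤ c * ‖x‖ ^ 2) : ‖T‖ ≤ c := by
  rw [T.norm_eq_iSup_rayleighQuotient hT.isSymmetric]
  refine ciSup_le fun x => ?_
  rw [ContinuousLinearMap.rayleighQuotient, abs_div, abs_sq]
  refine div_le_of_le_mul₀ (sq_nonneg _) hc0 ?_
  rw [ContinuousLinearMap.reApplyInnerSelf_apply, hT.isSymmetric.apply_clm]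
  exact hc x

end SesquilinearForms

section Calculus

theorem le_mul_exp_of_deriv_le {F F' : ℝ → ℝ} {a b K : ℝ}
    (hF : ∀ t ∈ Ico a b, HasDerivWithinAt F (F' t) (Ico a b) t)
    (hF' : ∀ t ∈ Ico a b, F' t ≤ K * F t) {t : ℝ} (ht : t ∈ Ico a b) :
    F t ≤ F a * Real.exp (K * (t - a)) := by
  have hsub : Icc a t ⊆ Ico a b := Icc_subset_Ico_right ht.2
  rw [← gronwallBound_ε0]
  refine le_gronwallBound_of_liminf_deriv_right_le (f' := F')
    (fun s hs => (hF s (hsub hs)).continuousWithinAt.mono hsub) (fun s hs r hr => ?_) le_rfl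
    (fun s hs => ?_) t (right_mem_Icc.mpr ht.1)
  · have hs := hsub (Ico_subset_Icc_self hs)
    exact ((hF s hs).mono_of_mem_nhdsWithin (Ico_mem_nhdsGE_of_mem hs)).liminf_right_slope_le hr
  · rw [add_zero]
    exact hF' s (hsub (Ico_subset_Icc_self hs))

variable {E : Type*} [NormedAddCommGroup E] [InnerProductSpace ℂ E]
  {w : ℝ → E} {w' : E} {s : Set ℝ} {t : ℝ}

theorem hasDerivWithinAt_re_inner_apply_self [CompleteSpace E] {T : E →L[ℂ] E}
    (hT : IsSelfAdjoint T) (hw : HasDerivWithinAt w w' s t) :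
    HasDerivWithinAt (fun r => (inner ℂ (w r) (T (w r))).re)
      (2 * (inner ℂ (T (w t)) w').re) s t := by
  have hTw : HasDerivWithinAt (fun r => T (w r)) (T w') s t :=
    (T.restrictScalars ℝ).hasFDerivAt.comp_hasDerivWithinAt t hw
  refine (Complex.reCLM.hasFDerivAt.comp_hasDerivWithinAt t (hw.inner ℂ hTw)).congr_deriv ?_
  rw [Complex.reCLM_apply, Complex.add_re, ← hT.isSymmetric.apply_clm, ← inner_conj_symm w',
    Complex.conj_re]
  ring

theorem norm_inner_apply_sub_inner_apply_le (T : E →L[ℂ] E) (x y : E) :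
    ‖inner ℂ x (T x) - inner ℂ y (T y)‖ ≤ ‖T‖ * ((‖x‖ + ‖y‖) * ‖x - y‖) := by
  have hsplit : inner ℂ x (T x) - inner ℂ y (T y) =
      inner ℂ (x - y) (T x) + inner ℂ y (T (x - y)) := by
    rw [inner_sub_left, map_sub, inner_sub_right]
    ring
  calc ‖inner ℂ x (T x) - inner ℂ y (T y)‖
      ≤ ‖x - y‖ * ‖T x‖ + ‖y‖ * ‖T (x - y)‖ := by
        rw [hsplit]
        exact (norm_add_le _ _).trans (add_le_add (norm_inner_le_norm _ _) (norm_inner_le_norm _ _))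
    _ ≤ ‖x - y‖ * (‖T‖ * ‖x‖) + ‖y‖ * (‖T‖ * ‖x - y‖) := by
        gcongr <;> exact T.le_opNorm _
    _ = ‖T‖ * ((‖x‖ + ‖y‖) * ‖x - y‖) := by ring

theorem hasDerivWithinAt_re_inner_sub_apply {k : ℝ → E →L[ℂ] E} {L : NNReal}
    (hk : LipschitzOnWith L k s) (ht : t ∈ s) (hw : ContinuousWithinAt w s t) :
    HasDerivWithinAt (fun r => (inner ℂ (w r) ((k r - k t) (w r)) -
      inner ℂ (w t) ((k r - k t) (w t))).re) 0 s t := by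
  rw [hasDerivWithinAt_iff_isLittleO]
  simp only [sub_self, zero_apply, inner_zero_right, Complex.zero_re, smul_zero, sub_zero]
  rw [Asymptotics.isLittleO_iff]
  intro ε hε
  have hlim : Tendsto (fun r => L * ((‖w r‖ + ‖w t‖) * ‖w r - w t‖)) (𝓝[s] t) (𝓝 0) := by
    have hwt : Tendsto w (𝓝[s] t) (𝓝 (w t)) := hw
    simpa using ((hwt.norm.add_const ‖w t‖).mul (hwt.sub_const (w t)).norm).const_mul (L : ℝ)
  filter_upwards [hlim.eventually_lt_const hε, self_mem_nhdsWithin] with r hr hrs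
  calc _ ≤ ‖k r - k t‖ * ((‖w r‖ + ‖w t‖) * ‖w r - w t‖) :=
        (Complex.abs_re_le_norm _).trans (norm_inner_apply_sub_inner_apply_le _ _ _)
    _ ≤ L * ‖r - t‖ * ((‖w r‖ + ‖w t‖) * ‖w r - w t‖) := by
        gcongr
        exact hk.norm_sub_le hrs ht
    _ = L * ((‖w r‖ + ‖w t‖) * ‖w r - w t‖) * ‖r - t‖ := by ring
    _ ≤ ε * ‖r - t‖ := by gcongr

theorem hasDerivWithinAt_re_inner_apply [CompleteSpace E] {k : ℝ → E →L[ℂ] E} {L : NNReal} {d : ℝ}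
    (hk : LipschitzOnWith L k s) (hkt : IsSelfAdjoint (k t)) (ht : t ∈ s)
    (hd : HasDerivWithinAt (fun r => (inner ℂ (w t) (k r (w t))).re) d s t)
    (hw : HasDerivWithinAt w w' s t) :
    HasDerivWithinAt (fun r => (inner ℂ (w r) (k r (w r))).re)
      (d + 2 * (inner ℂ (k t (w t)) w').re) s t := by
  have h := ((hd.add (hasDerivWithinAt_re_inner_apply_self hkt hw)).add
    (hasDerivWithinAt_re_inner_sub_apply hk ht hw.continuousWithinAt)).sub_const
      (inner ℂ (w t) (k t (w t))).re
  rw [add_zero] at h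
  refine h.congr (fun r _ => ?_) ?_ <;>
  · simp only [Pi.add_apply, sub_apply, inner_sub_right, Complex.sub_re]
    ring

end Calculus

section RegularizedEvolution

variable {E : Type*} [NormedAddCommGroup E] [InnerProductSpace ℂ E]

/-- The quadratic form `w ↦ ⟨w, (1 - ρ²) w⟩` of a self-adjoint operator `ρ`. If `ρ²` is the
resolvent `(A + 1)⁻¹`, this is the form of `A` at `ρ w`. -/
noncomputable def defectForm (ρ : E →L[ℂ] E) (w : E) : ℝ := ‖w‖ ^ 2 - ‖ρ w‖ ^ 2

/-- The quadratic form `u ↦ ⟨S u, (1 - S) u⟩`. If `S` is the resolvent `(B + 1)⁻¹`, this is the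
form of `B` at `S u`. -/
noncomputable def resolventForm (S : E →L[ℂ] E) (u : E) : ℝ := (inner ℂ (S u) (u - S u)).re

theorem continuous_defectForm (ρ : E →L[ℂ] E) : Continuous (defectForm ρ) := by
  unfold defectForm
  fun_prop

/-- The bounded reformulation of the evolution problem: `ρ² = (A + 1)⁻¹`, `S = (B + 1)⁻¹`, and
`⟨w, k(t) v⟩` is the value of the form `H(t)` at `(ρ w, ρ v)`. A vector lies in
`ran ρ ∩ ran S = Q(A) ∩ D(B)` if it is `ρ w = S u`, and then `B` maps it to `u - S u`. -/
structure IsEvolutionData [CompleteSpace E] (ρ S : E →L[ℂ] E) (k : ℝ → E →L[ℂ] E) (C β : ℝ) :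
    Prop where
  selfAdjoint_left : IsSelfAdjoint ρ
  injective_left : Function.Injective ρ
  selfAdjoint_right : IsSelfAdjoint S
  injective_right : Function.Injective S
  commute : Commute ρ S
  norm_sq_le : ∀ w, ‖ρ w‖ ^ 2 ≤ defectForm ρ w
  resolventForm_nonneg : ∀ u, 0 ≤ resolventForm S u
  pos : 0 < C
  bound_nonneg : 0 ≤ β
  lipschitz : ∃ L, LipschitzOnWith L k (Ico 0 1)
  selfAdjoint : ∀ t ∈ Ico (0 : ℝ) 1, IsSelfAdjoint (k t)
  upper : ∀ t ∈ Ico (0 : ℝ) 1, ∀ w, (inner ℂ w (k t w)).re ≤ C * defectForm ρ w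
  lower : ∀ t ∈ Ico (0 : ℝ) 1, ∀ w u, ρ w = S u →
    C⁻¹ * defectForm ρ w - C * resolventForm S u ≤ (inner ℂ w (k t w)).re
  relative : ∀ w u, ρ w = S u → resolventForm S u ≤ β * defectForm ρ w
  commutator : ∀ t ∈ Ico (0 : ℝ) 1, ∀ w u w', ρ w = S u → ρ w' = u - S u →
    (Complex.I * (inner ℂ w (k t w') - inner ℂ w' (k t w))).re ≤ C * defectForm ρ w
  deriv_le : ∀ t ∈ Ico (0 : ℝ) 1, ∀ w, ∃ d : ℝ,
    HasDerivWithinAt (fun s => (inner ℂ w (k s w)).re) d (Ico 0 1) t ∧ d ≤ C * defectForm ρ w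

variable [CompleteSpace E] {ρ S M N : E →L[ℂ] E} {k : ℝ → E →L[ℂ] E} {C β : ℝ}

theorem defectForm_eq (hρ : IsSelfAdjoint ρ) (w : E) :
    defectForm ρ w = (inner ℂ w ((1 - ρ * ρ) w)).re := by
  rw [defectForm, sub_apply, inner_sub_right, Complex.sub_re, mul_apply_eq_comp,
    ← hρ.isSymmetric.apply_clm, one_apply_eq_self, re_inner_self_eq_norm_sq,
    re_inner_self_eq_norm_sq]

theorem resolventForm_eq (hS : IsSelfAdjoint S) (u : E) :
    resolventForm S u = (inner ℂ u ((S - S * S) u)).re := by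
  rw [resolventForm, hS.isSymmetric.apply_clm, map_sub, sub_apply, mul_apply_eq_comp]

theorem isSelfAdjoint_sub_mul_self (hS : IsSelfAdjoint S) : IsSelfAdjoint (S - S * S) :=
  hS.sub hS.mul_self_nonneg.isSelfAdjoint

theorem hasDerivWithinAt_resolventForm (hS : IsSelfAdjoint S) {u : ℝ → E} {u' : E} {s : Set ℝ}
    {t : ℝ} (hu : HasDerivWithinAt u u' s t) :
    HasDerivWithinAt (fun r => resolventForm S (u r))
      (2 * (inner ℂ ((S - S * S) (u t)) u').re) s t := by
  simp only [resolventForm_eq hS]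
  exact hasDerivWithinAt_re_inner_apply_self (isSelfAdjoint_sub_mul_self hS) hu

namespace IsEvolutionData

theorem defectForm_nonneg (D : IsEvolutionData ρ S k C β) (w : E) : 0 ≤ defectForm ρ w :=
  (sq_nonneg _).trans (D.norm_sq_le w)

theorem norm_sq_le_two_mul (D : IsEvolutionData ρ S k C β) (w : E) :
    ‖w‖ ^ 2 ≤ 2 * defectForm ρ w := by
  have h := D.norm_sq_le w
  unfold defectForm at h ⊢
  linarith

theorem defectForm_apply_le (D : IsEvolutionData ρ S k C β) {J : E →L[ℂ] E} (hJ : Commute ρ J)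
    (hJ1 : ‖J‖ ≤ 1) (w : E) : defectForm ρ (J w) ≤ defectForm ρ w := by
  have hρ := D.selfAdjoint_left
  have hnonneg : 0 ≤ 1 - ρ * ρ := nonneg_of_isSelfAdjoint_of_re_inner_nonneg
    ((IsSelfAdjoint.one _).sub hρ.mul_self_nonneg.isSelfAdjoint)
    fun w => defectForm_eq hρ w ▸ D.defectForm_nonneg w
  rw [defectForm_eq hρ, defectForm_eq hρ]
  exact re_inner_apply_le_of_commute hnonneg
    ((Commute.one_left J).sub_left (hJ.mul_left hJ)) hJ1 w

theorem resolventForm_apply_le (D : IsEvolutionData ρ S k C β) {J : E →L[ℂ] E}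
    (hJ : Commute S J) (hJ1 : ‖J‖ ≤ 1) (u : E) : resolventForm S (J u) ≤ resolventForm S u := by
  have hS := D.selfAdjoint_right
  have hnonneg : 0 ≤ S - S * S :=
    nonneg_of_isSelfAdjoint_of_re_inner_nonneg (isSelfAdjoint_sub_mul_self hS)
      fun u => resolventForm_eq hS u ▸ D.resolventForm_nonneg u
  rw [resolventForm_eq hS, resolventForm_eq hS]
  exact re_inner_apply_le_of_commute hnonneg (hJ.sub_left (hJ.mul_left hJ)) hJ1 u

end IsEvolutionData

/-- `N = S M` is a bounded self-adjoint operator commuting with `ρ` and `S` for which `ρ N` is a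
contraction, so that `N` is a regularized inverse of `ρ` with range in `ran S`. -/
structure IsRegularizer (ρ S M N : E →L[ℂ] E) : Prop where
  mul_eq : S * M = N
  isSelfAdjoint : IsSelfAdjoint N
  commute_left : Commute ρ N
  commute_right : Commute S N
  norm_mul_le_one : ‖ρ * N‖ ≤ 1

theorem isRegularizer_tikhonovInverse (hρ : IsSelfAdjoint ρ) (hS : IsSelfAdjoint S)
    (hρS : Commute ρ S) {ε : ℝ} (hε : 0 < ε) :
    IsRegularizer ρ S (tikhonovInverse (ρ * S) ε) (S * tikhonovInverse (ρ * S) ε) := by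
  have hρM : Commute ρ (tikhonovInverse (ρ * S) ε) :=
    (commute_tikhonovInverse ((Commute.refl ρ).mul_left hρS.symm) ε).symm
  have hSM : Commute S (tikhonovInverse (ρ * S) ε) :=
    (commute_tikhonovInverse (hρS.mul_left (Commute.refl S)) ε).symm
  refine ⟨rfl, (hS.commute_iff (isSelfAdjoint_tikhonovInverse _ ε)).mp hSM, hρS.mul_right hρM,
    (Commute.refl S).mul_right hSM, ?_⟩
  rw [← mul_assoc]
  exact norm_mul_tikhonovInverse_le ((hρ.commute_iff hS).mp hρS) hε

namespace IsRegularizer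

theorem apply_apply (R : IsRegularizer ρ S M N) (x : E) : S (M x) = N x :=
  DFunLike.congr_fun R.mul_eq x

theorem left_apply (R : IsRegularizer ρ S M N) (x : E) : ρ (N x) = N (ρ x) :=
  DFunLike.congr_fun R.commute_left.eq x

theorem right_apply (R : IsRegularizer ρ S M N) (x : E) : S (N x) = N (S x) :=
  DFunLike.congr_fun R.commute_right.eq x

theorem left_apply_right (R : IsRegularizer ρ S M N) (hρS : Commute ρ S) (u : E) :
    ρ (N (S u)) = S ((ρ * N) u) := by
  rw [← R.right_apply, mul_apply_eq_comp]
  exact DFunLike.congr_fun hρS.eq (N u)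

theorem left_apply_sub (R : IsRegularizer ρ S M N) (hρS : Commute ρ S) (u : E) :
    ρ (N (u - S u)) = (ρ * N) u - S ((ρ * N) u) := by
  rw [map_sub, map_sub, R.left_apply_right hρS, mul_apply_eq_comp]

theorem commute_left_mul (R : IsRegularizer ρ S M N) : Commute ρ (ρ * N) :=
  (Commute.refl ρ).mul_right R.commute_left

theorem commute_right_mul (R : IsRegularizer ρ S M N) (hρS : Commute ρ S) : Commute S (ρ * N) :=
  hρS.symm.mul_right R.commute_right

theorem right_apply_initial (R : IsRegularizer ρ S M N) (hρS : Commute ρ S) (w : E) :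
    S (ρ (M (ρ w))) = ρ ((ρ * N) w) := by
  rw [mul_apply_eq_comp, R.left_apply, ← R.apply_apply]
  exact (DFunLike.congr_fun hρS.eq (M (ρ w))).symm

theorem hasDerivWithinAt_comp (R : IsRegularizer ρ S M N) {K : E →L[ℂ] E} {u : ℝ → E}
    {s : Set ℝ} {t : ℝ} (hu : HasDerivWithinAt u (-Complex.I • M (K (N (S (u t))))) s t) :
    HasDerivWithinAt (fun r => N (S (u r))) (-Complex.I • N (N (K (N (S (u t)))))) s t := by
  refine (((N * S).restrictScalars ℝ).hasFDerivAt.comp_hasDerivWithinAt t hu).congr_deriv ?_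
  rw [ContinuousLinearMap.coe_restrictScalars', mul_apply_eq_comp, map_smul, R.apply_apply,
    map_smul]

/-- The commutator of the regularized Hamiltonian with `B` is the one of `H` with `B`, evaluated
at the regularized vector. -/
theorem two_mul_re_inner_eq_commutator {K : E →L[ℂ] E} (R : IsRegularizer ρ S M N)
    (hS : IsSelfAdjoint S) (hK : IsSelfAdjoint K) (u w : E) :
    2 * (inner ℂ ((S - S * S) u) (-Complex.I • M (K w))).re =
      (Complex.I * (inner ℂ w (K (N (u - S u))) - inner ℂ (N (u - S u)) (K w))).re := by
  have hleft : inner ℂ ((S - S * S) u) (M (K w)) = inner ℂ (N (u - S u)) (K w) := by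
    rw [R.isSelfAdjoint.isSymmetric.apply_clm, ← R.apply_apply, ← hS.isSymmetric.apply_clm,
      map_sub, sub_apply, mul_apply_eq_comp]
  rw [inner_smul_right, hleft, ← hK.isSymmetric.apply_clm w, ← inner_conj_symm (K w)]
  simp only [Complex.mul_re, Complex.neg_re, Complex.neg_im, Complex.I_re, Complex.I_im,
    Complex.sub_re, Complex.sub_im, Complex.conj_re, Complex.conj_im]
  ring

end IsRegularizer

/-- The Lyapunov function of the regularized evolution: for `u` with `x = N (S u)` it corresponds
to the form of `H + C B`, where the contraction `ρ N` has been dropped from the second summand. -/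
noncomputable def regularizedEnergy (S N K : E →L[ℂ] E) (C : ℝ) (u : E) : ℝ :=
  (inner ℂ (N (S u)) (K (N (S u)))).re + C * resolventForm S u

namespace IsEvolutionData

theorem defectForm_le_regularizedEnergy (D : IsEvolutionData ρ S k C β)
    (R : IsRegularizer ρ S M N) {t : ℝ} (ht : t ∈ Ico (0 : ℝ) 1) (u : E) :
    defectForm ρ (N (S u)) ≤ C * regularizedEnergy S N (k t) C u := by
  have hlower := D.lower t ht _ _ (R.left_apply_right D.commute u)
  have hcontr := mul_le_mul_of_nonneg_left
    (D.resolventForm_apply_le (R.commute_right_mul D.commute) R.norm_mul_le_one u) D.pos.le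
  rw [← inv_mul_le_iff₀ D.pos, regularizedEnergy]
  linarith

theorem regularizedEnergy_initial_le (D : IsEvolutionData ρ S k C β)
    (R : IsRegularizer ρ S M N) (w : E) :
    regularizedEnergy S N (k 0) C (ρ (M (ρ w))) ≤ (C + C * β) * defectForm ρ w := by
  have hinit := R.right_apply_initial D.commute w
  have hcontr := D.defectForm_apply_le R.commute_left_mul R.norm_mul_le_one
  have hform : defectForm ρ (N (S (ρ (M (ρ w))))) ≤ defectForm ρ w := by
    rw [hinit, ← R.left_apply]
    exact (hcontr _).trans (hcontr w)
  have hrel : resolventForm S (ρ (M (ρ w))) ≤ β * defectForm ρ w :=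
    (D.relative _ _ hinit.symm).trans (mul_le_mul_of_nonneg_left (hcontr w) D.bound_nonneg)
  have hC := D.pos
  calc regularizedEnergy S N (k 0) C (ρ (M (ρ w)))
      ≤ C * defectForm ρ w + C * (β * defectForm ρ w) := by
        unfold regularizedEnergy
        gcongr
        exact (D.upper 0 (by simp) _).trans (by gcongr)
    _ = (C + C * β) * defectForm ρ w := by ring

theorem exists_hasDerivWithinAt_regularizedEnergy (D : IsEvolutionData ρ S k C β)
    (R : IsRegularizer ρ S M N) {u : ℝ → E} {t : ℝ} (ht : t ∈ Ico (0 : ℝ) 1)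
    (hu : HasDerivWithinAt u (-Complex.I • M (k t (N (S (u t))))) (Ico 0 1) t) :
    ∃ d, HasDerivWithinAt (fun r => regularizedEnergy S N (k r) C (u r)) d (Ico 0 1) t ∧
      d ≤ (C ^ 2 + C ^ 3) * regularizedEnergy S N (k t) C (u t) := by
  have hC := D.pos
  have hN := R.isSelfAdjoint
  have hw := R.hasDerivWithinAt_comp hu
  set w := N (S (u t)) with hw_def
  obtain ⟨L, hL⟩ := D.lipschitz
  obtain ⟨d, hd, hd_le⟩ := D.deriv_le t ht w
  refine ⟨_, (hasDerivWithinAt_re_inner_apply hL (D.selfAdjoint t ht) ht hd hw).add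
    ((hasDerivWithinAt_resolventForm D.selfAdjoint_right hu).const_mul C), ?_⟩
  have hconserved : (inner ℂ (k t w) (-Complex.I • N (N (k t w)))).re = 0 := by
    rw [inner_smul_right, ← hN.isSymmetric.apply_clm, inner_self_eq_norm_sq_to_K]
    simp [← Complex.ofReal_pow]
  have hcomm := D.commutator t ht w _ _ (R.left_apply_right D.commute (u t))
    (R.left_apply_sub D.commute (u t))
  have henergy := D.defectForm_le_regularizedEnergy R ht (u t)
  rw [← hw_def, hconserved,
    R.two_mul_re_inner_eq_commutator D.selfAdjoint_right (D.selfAdjoint t ht)]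
  calc _ ≤ C * defectForm ρ w + 2 * 0 + C * (C * defectForm ρ w) := by gcongr
    _ = (C + C ^ 2) * defectForm ρ w := by ring
    _ ≤ (C + C ^ 2) * (C * regularizedEnergy S N (k t) C (u t)) := by gcongr
    _ = (C ^ 2 + C ^ 3) * regularizedEnergy S N (k t) C (u t) := by ring

theorem exists_regularized_solution (D : IsEvolutionData ρ S k C β) (u₀ : E) :
    ∃ u : ℝ → E, u 0 = u₀ ∧ ∀ t ∈ Ico (0 : ℝ) 1,
      HasDerivWithinAt u (-Complex.I • M (k t (N (S (u t))))) (Ico 0 1) t := by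
  obtain ⟨L, hL⟩ := D.lipschitz
  have hcont := continuousOn_extendFrom_closure hL.uniformContinuousOn
  rw [closure_Ico zero_ne_one] at hcont
  obtain ⟨u, hu₀, hu⟩ := exists_hasDerivWithinAt_clm_apply zero_le_one
    (L := fun t => -Complex.I • (M * (extendFrom (Ico 0 1) k t * (N * S)))) (by fun_prop) u₀
  refine ⟨u, hu₀, fun t ht => ?_⟩
  have hkt : extendFrom (Ico 0 1) k t = k t :=
    extendFrom_extends hL.continuousOn t ht
  have h := (hu t (Ico_subset_Icc_self ht)).mono Ico_subset_Icc_self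
  rwa [hkt] at h

theorem exists_regularized (D : IsEvolutionData ρ S k C β) (R : IsRegularizer ρ S M N) (w₀ : E) :
    ∃ w : ℝ → E, w 0 = (ρ * N) ((ρ * N) w₀) ∧
      (∀ y, ∀ t ∈ Ico (0 : ℝ) 1, HasDerivWithinAt (fun s => inner ℂ (ρ (ρ y)) (w s))
        (-Complex.I * inner ℂ ((ρ * N) ((ρ * N) y)) (k t (w t))) (Ico 0 1) t) ∧
      ∀ t ∈ Ico (0 : ℝ) 1, defectForm ρ (w t) ≤
        C * (C + C * β) * Real.exp ((C ^ 2 + C ^ 3) * t) * defectForm ρ w₀ := by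
  have hC := D.pos
  have hN := R.isSelfAdjoint.isSymmetric
  obtain ⟨u, hu₀, hu⟩ := D.exists_regularized_solution (M := M) (N := N) (ρ (M (ρ w₀)))
  refine ⟨fun s => N (S (u s)), ?_, fun y t ht => ?_, fun t ht => ?_⟩
  · change N (S (u 0)) = _
    rw [hu₀, R.right_apply_initial D.commute, ← R.left_apply]
    rfl
  · refine ((hasDerivWithinAt_const t _ (ρ (ρ y))).inner ℂ
      (R.hasDerivWithinAt_comp (hu t ht))).congr_deriv ?_
    simp only [mul_apply_eq_comp]
    rw [inner_zero_left, add_zero, inner_smul_right, ← hN.apply_clm, ← hN.apply_clm,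
      ← R.left_apply, ← R.left_apply, R.left_apply y]
  · choose! F' hF' hF'_le using fun s hs =>
      D.exists_hasDerivWithinAt_regularizedEnergy R hs (hu s hs)
    have hgronwall := le_mul_exp_of_deriv_le hF' hF'_le ht
    have hinit := D.regularizedEnergy_initial_le R w₀
    rw [sub_zero, hu₀] at hgronwall
    calc defectForm ρ (N (S (u t))) ≤ C * regularizedEnergy S N (k t) C (u t) :=
          D.defectForm_le_regularizedEnergy R ht (u t)
      _ ≤ C * ((C + C * β) * defectForm ρ w₀ * Real.exp ((C ^ 2 + C ^ 3) * t)) := by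
          gcongr
          exact hgronwall.trans (by gcongr)
      _ = _ := by ring

end IsEvolutionData

end RegularizedEvolution

section WeakConvergence

variable {ι E : Type*} [NormedAddCommGroup E] [InnerProductSpace ℂ E] {l : Filter ι} {x : ι → E}
  {x' : E} {M : ℝ}

theorem tendsto_inner_of_tendsto_of_norm_le {y : ι → E} {y' : E} {c : ℂ}
    (hM : ∀ᶠ i in l, ‖x i‖ ≤ M) (hy : Tendsto y l (𝓝 y'))
    (hx : Tendsto (fun i => inner ℂ y' (x i)) l (𝓝 c)) :
    Tendsto (fun i => inner ℂ (y i) (x i)) l (𝓝 c) := by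
  have hdiff : Tendsto (fun i => inner ℂ (y i - y') (x i)) l (𝓝 0) := by
    refine squeeze_zero_norm' ?_ (by simpa using (hy.sub_const y').norm.mul_const M)
    filter_upwards [hM] with i hi
    exact (norm_inner_le_norm _ _).trans (by gcongr)
  simpa [inner_sub_left] using hdiff.add hx

theorem tendsto_inner_of_dense (hM : ∀ᶠ i in l, ‖x i‖ ≤ M) {D : Set E} (hD : Dense D)
    (hx : ∀ y ∈ D, Tendsto (fun i => inner ℂ y (x i)) l (𝓝 (inner ℂ y x'))) (y : E) :
    Tendsto (fun i => inner ℂ y (x i)) l (𝓝 (inner ℂ y x')) := by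
  have hconj := (Complex.continuous_conj.tendsto _).comp <|
    tendsto_apply_of_opNorm_le_of_dense (T := fun i => innerSL ℂ (x i)) (T₀ := innerSL ℂ x')
      (by simpa using hM) hD (fun y hy => by
        simpa [Function.comp_def] using (Complex.continuous_conj.tendsto _).comp (hx y hy)) y
  simpa [Function.comp_def] using hconj

theorem tendsto_apply_apply_of_opNorm_le_one {J : ι → E →L[ℂ] E} (hJ1 : ∀ i, ‖J i‖ ≤ 1)
    (hJ : ∀ x, Tendsto (fun i => J i x) l (𝓝 x)) (x : E) :
    Tendsto (fun i => J i (J i x)) l (𝓝 x) := by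
  rw [tendsto_iff_norm_sub_tendsto_zero]
  refine squeeze_zero (fun _ => norm_nonneg _) (fun i => ?_)
    (by simpa using ((hJ x).sub_const x).norm.const_mul 2)
  calc ‖J i (J i x) - x‖ = ‖J i (J i x - x) + (J i x - x)‖ := by simp
    _ ≤ ‖J i (J i x - x)‖ + ‖J i x - x‖ := norm_add_le _ _
    _ ≤ 1 * ‖J i x - x‖ + ‖J i x - x‖ := by
        gcongr
        exact (J i).le_of_opNorm_le (hJ1 i) _
    _ = 2 * ‖J i x - x‖ := by ring

theorem norm_inner_sub_le_of_hasDerivWithinAt {s : Set ℝ} (hs : Convex ℝ s) {w v : ℝ → E}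
    {y z : E} {K : ℝ}
    (hw : ∀ t ∈ s, HasDerivWithinAt (fun r => inner ℂ z (w r)) (-Complex.I * inner ℂ y (v t)) s t)
    (hK : ∀ t ∈ s, ‖v t‖ ≤ K) {t r : ℝ} (ht : t ∈ s) (hr : r ∈ s) :
    ‖inner ℂ z (w r - w t)‖ ≤ ‖y‖ * K * ‖r - t‖ := by
  rw [inner_sub_right]
  refine hs.norm_image_sub_le_of_norm_hasDerivWithin_le hw (fun t ht => ?_) ht hr
  rw [norm_mul, norm_neg, Complex.norm_I, one_mul]
  exact (norm_inner_le_norm _ _).trans (by gcongr; exact hK t ht)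

variable [CompleteSpace E]

theorem exists_apply_eq_of_tendsto [l.NeBot] (hM : ∀ᶠ i in l, ‖x i‖ ≤ M) {T : E →L[ℂ] E} {y : E}
    (hT : Tendsto (fun i => T (x i)) l (𝓝 y)) : ∃ x', T x' = y ∧ ‖x'‖ ≤ M := by
  have hU : ↑(Ultrafilter.of l) ≤ l := Ultrafilter.of_le l
  obtain ⟨x', hx', hlim⟩ := exists_weak_limit (Ultrafilter.of l) (hM.filter_mono hU)
  refine ⟨x', ext_inner_left ℂ fun v => ?_, hx'⟩
  have hweak := hlim (T.adjoint v)
  simp only [ContinuousLinearMap.adjoint_inner_left] at hweak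
  exact tendsto_nhds_unique hweak (tendsto_const_nhds.inner (hT.mono_left hU))

theorem defectForm_le_of_weak_limit [l.NeBot] {ρ : E →L[ℂ] E} (hρ : IsSelfAdjoint ρ)
    (hpos : ∀ w, 0 ≤ defectForm ρ w) {b : ℝ}
    (hx : ∀ y, Tendsto (fun i => inner ℂ y (x i)) l (𝓝 (inner ℂ y x')))
    (hb : ∀ i, defectForm ρ (x i) ≤ b) : defectForm ρ x' ≤ b := by
  have hpolar : ∀ i, 2 * ((inner ℂ x' (x i)).re - (inner ℂ (ρ (ρ x')) (x i)).re) ≤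
      defectForm ρ x' + b := by
    intro i
    have hdiff := hpos (x' - x i)
    have hbi := hb i
    unfold defectForm at hdiff hbi ⊢
    rw [map_sub, norm_sub_sq (𝕜 := ℂ), norm_sub_sq (𝕜 := ℂ), ← hρ.isSymmetric.apply_clm,
      RCLike.re_to_complex, RCLike.re_to_complex] at hdiff
    linarith
  have hlim : ∀ y, Tendsto (fun i => (inner ℂ y (x i)).re) l (𝓝 (inner ℂ y x').re) :=
    fun y => (Complex.continuous_re.tendsto _).comp (hx y)
  have hle := le_of_tendsto (((hlim x').sub (hlim (ρ (ρ x')))).const_mul 2)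
    (Eventually.of_forall hpolar)
  rw [hρ.isSymmetric.apply_clm, re_inner_self_eq_norm_sq, re_inner_self_eq_norm_sq] at hle
  unfold defectForm at hle ⊢
  linarith

variable {ρ : E →L[ℂ] E} {k : ℝ → E →L[ℂ] E} {w : ℝ → E} {s : Set ℝ}

theorem continuousOn_inner_of_continuousOn_apply (hρ : IsSelfAdjoint ρ)
    (hinj : Function.Injective ρ) (hM : ∀ t ∈ s, ‖w t‖ ≤ M)
    (hw : ContinuousOn (fun t => ρ (w t)) s) (y : E) :
    ContinuousOn (fun t => inner ℂ y (w t)) s := by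
  intro t ht
  refine tendsto_inner_of_dense (eventually_nhdsWithin_of_forall hM)
    (denseRange_of_isSelfAdjoint_of_injective hρ hinj) ?_ y
  rintro _ ⟨v, rfl⟩
  simp only [hρ.isSymmetric.apply_clm]
  exact tendsto_const_nhds.inner (hw t ht)

theorem continuousOn_inner_clm_apply (hk : ContinuousOn k s) (hsa : ∀ t ∈ s, IsSelfAdjoint (k t))
    (hM : ∀ t ∈ s, ‖w t‖ ≤ M) (hw : ∀ y, ContinuousOn (fun t => inner ℂ y (w t)) s) (y : E) :
    ContinuousOn (fun t => inner ℂ y (k t (w t))) s := by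
  refine ContinuousOn.congr (f := fun t => inner ℂ (k t y) (w t)) (fun t ht => ?_)
    fun t ht => ((hsa t ht).isSymmetric.apply_clm y (w t)).symm
  exact tendsto_inner_of_tendsto_of_norm_le (eventually_nhdsWithin_of_forall hM)
    ((hk.clm_apply continuousOn_const) t ht) (hw (k t y) t ht)

theorem continuousOn_apply_of_norm_inner_sub_le (hρ : IsSelfAdjoint ρ) {K : ℝ}
    (hM : ∀ t ∈ s, ‖w t‖ ≤ M)
    (hw : ∀ y, ∀ t ∈ s, ∀ r ∈ s, ‖inner ℂ (ρ (ρ y)) (w r - w t)‖ ≤ ‖y‖ * K * ‖r - t‖) :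
    ContinuousOn (fun t => ρ (w t)) s := by
  have hsq : ∀ t ∈ s, ∀ r ∈ s, ‖ρ (w r) - ρ (w t)‖ ^ 2 ≤ 2 * M * |K| * ‖r - t‖ := by
    intro t ht r hr
    have hle := hw (w r - w t) t ht r hr
    rw [hρ.isSymmetric.apply_clm, inner_self_eq_norm_sq_to_K, norm_pow, RCLike.norm_ofReal,
      abs_norm, map_sub] at hle
    have hdiam : ‖w r - w t‖ ≤ 2 * M := by linarith [norm_sub_le (w r) (w t), hM r hr, hM t ht]
    calc ‖ρ (w r) - ρ (w t)‖ ^ 2 ≤ ‖w r - w t‖ * K * ‖r - t‖ := hle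
      _ ≤ ‖w r - w t‖ * |K| * ‖r - t‖ := by gcongr; exact le_abs_self K
      _ ≤ 2 * M * |K| * ‖r - t‖ := by gcongr
  intro t ht
  rw [ContinuousWithinAt, tendsto_iff_norm_sub_tendsto_zero]
  have hlim : Tendsto (fun r => √(2 * M * |K| * ‖r - t‖)) (𝓝[s] t) (𝓝 0) := by
    have hcont : Continuous fun r => √(2 * M * |K| * ‖r - t‖) := by fun_prop
    have h := (hcont.tendsto t).mono_left (nhdsWithin_le_nhds (s := s))
    rwa [sub_self, norm_zero, mul_zero, Real.sqrt_zero] at h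
  refine squeeze_zero' (Eventually.of_forall fun _ => norm_nonneg _) ?_ hlim
  filter_upwards [self_mem_nhdsWithin] with r hr
  exact Real.le_sqrt_of_sq_le (hsq t ht r hr)

end WeakConvergence

section WeakEvolution

variable {E : Type*} [NormedAddCommGroup E] [InnerProductSpace ℂ E] {ρ : E →L[ℂ] E}
  {k : ℝ → E →L[ℂ] E} {w w' : ℝ → E} {w₀ : E} {M Λ : ℝ}

/-- The curve `x(t) = ρ w(t)` is a solution of `i ẋ(t) = H(t) x(t)` which is bounded in the form
norm, where `k` represents `H` as in `IsEvolutionData` and the derivative is taken weakly, after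
pairing with the vectors `ρ y`. -/
structure IsWeakEvolution (ρ : E →L[ℂ] E) (k : ℝ → E →L[ℂ] E) (w : ℝ → E) : Prop where
  exists_norm_le : ∃ M, ∀ t ∈ Ico (0 : ℝ) 1, ‖w t‖ ≤ M
  continuousOn : ContinuousOn (fun t => ρ (w t)) (Ico 0 1)
  hasDerivAt : ∀ y, ∀ t ∈ Ioo (0 : ℝ) 1,
    HasDerivAt (fun s => inner ℂ (ρ (ρ y)) (w s)) (-Complex.I * inner ℂ y (k t (w t))) t

namespace IsWeakEvolution

theorem sub (h : IsWeakEvolution ρ k w) (h' : IsWeakEvolution ρ k w') :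
    IsWeakEvolution ρ k fun t => w t - w' t := by
  obtain ⟨M, hM⟩ := h.exists_norm_le
  obtain ⟨M', hM'⟩ := h'.exists_norm_le
  refine ⟨⟨M + M', fun t ht => (norm_sub_le _ _).trans (add_le_add (hM t ht) (hM' t ht))⟩,
    by simpa only [map_sub] using h.continuousOn.fun_sub h'.continuousOn, fun y t ht => ?_⟩
  simpa only [map_sub, inner_sub_right, mul_sub] using
    (h.hasDerivAt y t ht).fun_sub (h'.hasDerivAt y t ht)

variable [CompleteSpace E]

theorem norm_sq_eq_of_mem_Ioo (h : IsWeakEvolution ρ k w) (hρ : IsSelfAdjoint ρ)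
    (hsa : ∀ t ∈ Ico (0 : ℝ) 1, IsSelfAdjoint (k t)) {a b : ℝ} (ha : a ∈ Ioo (0 : ℝ) 1)
    (hb : b ∈ Ioo (0 : ℝ) 1) (hab : a ≤ b) : ‖ρ (w a)‖ ^ 2 = ‖ρ (w b)‖ ^ 2 := by
  have hsub : Icc a b ⊆ Ioo 0 1 := Icc_subset_Ioo ha.1 hb.2
  refine eq_of_lower_support (f := fun t => ‖ρ (w t)‖ ^ 2) hab
    ((h.continuousOn.norm.pow 2).mono (hsub.trans Ioo_subset_Ico_self)) fun t ht => ?_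
  have hsymm := (hsa t (Ioo_subset_Ico_self (hsub ht))).isSymmetric
  -- `t ↦ ‖ρ w(t)‖²` need not be differentiable, but it dominates its tangents `m`.
  refine ⟨fun s => 2 * (inner ℂ (ρ (ρ (w t))) (w s)).re - ‖ρ (w t)‖ ^ 2, ?_, ?_, fun s => ?_⟩
  · have hderiv := Complex.reCLM.hasFDerivAt.comp_hasDerivAt t (h.hasDerivAt (w t) t (hsub ht))
    refine ((hderiv.const_mul 2).sub_const _).congr_deriv ?_
    have him : (inner ℂ (w t) (k t (w t))).im = 0 := by
      rw [← Complex.conj_eq_iff_im, inner_conj_symm, hsymm.apply_clm]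
    simp [him]
  · simp only [hρ.isSymmetric.apply_clm (ρ (w t)), re_inner_self_eq_norm_sq]
    ring
  · have hsq := sq_nonneg ‖ρ (w t) - ρ (w s)‖
    rw [norm_sub_sq (𝕜 := ℂ), RCLike.re_to_complex] at hsq
    simp only [hρ.isSymmetric.apply_clm (ρ (w t))]
    linarith

theorem norm_eq (h : IsWeakEvolution ρ k w) (hρ : IsSelfAdjoint ρ)
    (hsa : ∀ t ∈ Ico (0 : ℝ) 1, IsSelfAdjoint (k t)) {t : ℝ} (ht : t ∈ Ico (0 : ℝ) 1) :
    ‖ρ (w t)‖ = ‖ρ (w 0)‖ := by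
  rcases ht.1.eq_or_lt with rfl | h0
  · rfl
  have hlim : Tendsto (fun s => ‖ρ (w s)‖ ^ 2) (𝓝[>] 0) (𝓝 (‖ρ (w 0)‖ ^ 2)) := by
    rw [← nhdsWithin_Ioo_eq_nhdsGT (zero_lt_one' ℝ)]
    exact ((h.continuousOn.norm.pow 2) 0 (by simp)).mono_left
      (nhdsWithin_mono 0 Ioo_subset_Ico_self)
  have hconst : (fun s => ‖ρ (w s)‖ ^ 2) =ᶠ[𝓝[>] 0] fun _ => ‖ρ (w t)‖ ^ 2 := by
    filter_upwards [Ioo_mem_nhdsGT h0] with s hs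
    exact h.norm_sq_eq_of_mem_Ioo hρ hsa ⟨hs.1, hs.2.trans ht.2⟩ ⟨h0, ht.2⟩ hs.2.le
  exact (sq_eq_sq₀ (norm_nonneg _) (norm_nonneg _)).mp
    (tendsto_nhds_unique tendsto_const_nhds (hlim.congr' hconst))

theorem eq_of_initial (h : IsWeakEvolution ρ k w) (h' : IsWeakEvolution ρ k w')
    (hρ : IsSelfAdjoint ρ) (hsa : ∀ t ∈ Ico (0 : ℝ) 1, IsSelfAdjoint (k t))
    (h0 : ρ (w 0) = ρ (w' 0)) {t : ℝ} (ht : t ∈ Ico (0 : ℝ) 1) : ρ (w t) = ρ (w' t) := by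
  have hnorm := (h.sub h').norm_eq hρ hsa ht
  rwa [map_sub, map_sub, h0, sub_self, norm_zero, norm_eq_zero, sub_eq_zero] at hnorm

end IsWeakEvolution

/-- The curves `W n` are bounded in the form norm and solve the weak evolution equation of `k`
regularized by contractions `J n` which converge strongly to the identity. -/
structure IsApproximateEvolution (ρ : E →L[ℂ] E) (k : ℝ → E →L[ℂ] E) (w₀ : E) (M : ℝ)
    (J : ℕ → E →L[ℂ] E) (W : ℕ → ℝ → E) : Prop where
  opNorm_le_one : ∀ n, ‖J n‖ ≤ 1
  tendsto_apply : ∀ y, Tendsto (fun n => J n y) atTop (𝓝 y)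
  initial : ∀ n, W n 0 = J n (J n w₀)
  norm_le : ∀ n, ∀ t ∈ Ico (0 : ℝ) 1, ‖W n t‖ ≤ M
  hasDerivWithinAt : ∀ n y, ∀ t ∈ Ico (0 : ℝ) 1,
    HasDerivWithinAt (fun s => inner ℂ (ρ (ρ y)) (W n s))
      (-Complex.I * inner ℂ (J n (J n y)) (k t (W n t))) (Ico 0 1) t

theorem hasDerivAt_of_tendsto_prod {ι : Type*} {l : Filter ι} [l.NeBot] {f f' : ι → ℝ → ℂ}
    {g : ℝ → ℂ} {c : ℂ} {t : ℝ} (hf : ∀ᶠ p in l ×ˢ 𝓝 t, HasDerivAt (f p.1) (f' p.1 p.2) p.2)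
    (hf' : Tendsto (fun p : ι × ℝ => f' p.1 p.2) (l ×ˢ 𝓝 t) (𝓝 c))
    (hg : ∀ᶠ r in 𝓝 t, Tendsto (fun i => f i r) l (𝓝 (g r))) : HasDerivAt g c t :=
  hasDerivAt_of_tendstoUniformlyOnFilter (g' := fun _ => c) (tendsto_prod_filter_iff.mp hf') hf hg

namespace IsApproximateEvolution

variable {J : ℕ → E →L[ℂ] E} {W : ℕ → ℝ → E} {l : Filter ℕ}

theorem norm_inner_sub_le (h : IsApproximateEvolution ρ k w₀ M J W)
    (hΛ : ∀ t ∈ Ico (0 : ℝ) 1, ‖k t‖ ≤ Λ) (n : ℕ) (y : E) {t r : ℝ} (ht : t ∈ Ico (0 : ℝ) 1)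
    (hr : r ∈ Ico (0 : ℝ) 1) :
    ‖inner ℂ (ρ (ρ y)) (W n r - W n t)‖ ≤ ‖y‖ * (Λ * M) * ‖r - t‖ := by
  have hJ : ∀ y, ‖J n y‖ ≤ ‖y‖ := fun y => by
    simpa using (J n).le_of_opNorm_le (h.opNorm_le_one n) y
  have hkW : ∀ s ∈ Ico (0 : ℝ) 1, ‖k s (W n s)‖ ≤ Λ * M := fun s hs =>
    (k s).le_of_opNorm_le_of_le (hΛ s hs) (h.norm_le n s hs)
  have hΛM : 0 ≤ Λ * M := (norm_nonneg _).trans (hkW t ht)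
  refine (norm_inner_sub_le_of_hasDerivWithinAt (convex_Ico 0 1) (h.hasDerivWithinAt n y) hkW ht
    hr).trans ?_
  gcongr
  exact (hJ _).trans (hJ y)

theorem norm_inner_sub_le_of_weak_limit [l.NeBot] (h : IsApproximateEvolution ρ k w₀ M J W)
    (hΛ : ∀ t ∈ Ico (0 : ℝ) 1, ‖k t‖ ≤ Λ)
    (hw : ∀ t ∈ Ico (0 : ℝ) 1, ∀ v, Tendsto (fun n => inner ℂ v (W n t)) l (𝓝 (inner ℂ v (w t))))
    (y : E) {t r : ℝ} (ht : t ∈ Ico (0 : ℝ) 1) (hr : r ∈ Ico (0 : ℝ) 1) :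
    ‖inner ℂ (ρ (ρ y)) (w r - w t)‖ ≤ ‖y‖ * (Λ * M) * ‖r - t‖ := by
  rw [inner_sub_right]
  refine le_of_tendsto ((hw r hr _).sub (hw t ht _)).norm (Eventually.of_forall fun n => ?_)
  rw [← inner_sub_right]
  exact h.norm_inner_sub_le hΛ n y ht hr

variable [CompleteSpace E]

theorem tendsto_inner_prod (h : IsApproximateEvolution ρ k w₀ M J W) (hρ : IsSelfAdjoint ρ)
    (hinj : Function.Injective ρ) (hΛ : ∀ t ∈ Ico (0 : ℝ) 1, ‖k t‖ ≤ Λ)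
    {t : ℝ} (ht : t ∈ Ioo (0 : ℝ) 1) {x : E}
    (hw : ∀ v, Tendsto (fun n => inner ℂ v (W n t)) l (𝓝 (inner ℂ v x))) (v : E) :
    Tendsto (fun p : ℕ × ℝ => inner ℂ v (W p.1 p.2)) (l ×ˢ 𝓝 t) (𝓝 (inner ℂ v x)) := by
  have hmem : ∀ᶠ p in l ×ˢ 𝓝 t, p.2 ∈ Ico (0 : ℝ) 1 :=
    tendsto_snd.eventually (Ico_mem_nhds ht.1 ht.2)
  have hdense : DenseRange (ρ * ρ) := denseRange_of_isSelfAdjoint_of_injective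
    hρ.mul_self_nonneg.isSelfAdjoint (hinj.comp hinj)
  refine tendsto_inner_of_dense (hmem.mono fun p hp => h.norm_le p.1 p.2 hp) hdense ?_ v
  rintro _ ⟨y, rfl⟩
  have hdiff : Tendsto (fun p : ℕ × ℝ => inner ℂ (ρ (ρ y)) (W p.1 p.2 - W p.1 t)) (l ×ˢ 𝓝 t)
      (𝓝 0) := by
    refine squeeze_zero_norm' (a := fun p => ‖y‖ * (Λ * M) * ‖p.2 - t‖)
      (hmem.mono fun p hp => h.norm_inner_sub_le hΛ p.1 y (Ioo_subset_Ico_self ht) hp) ?_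
    simpa using ((tendsto_snd (f := l) (g := 𝓝 t)).sub_const t).norm.const_mul (‖y‖ * (Λ * M))
  simpa [inner_sub_right] using hdiff.add ((hw (ρ (ρ y))).comp tendsto_fst)

theorem hasDerivAt_of_weak_limit [l.NeBot] (h : IsApproximateEvolution ρ k w₀ M J W)
    (hl : l ≤ atTop) (hρ : IsSelfAdjoint ρ) (hinj : Function.Injective ρ)
    (hΛ : ∀ t ∈ Ico (0 : ℝ) 1, ‖k t‖ ≤ Λ) (hk : ContinuousOn k (Ico 0 1))
    (hsa : ∀ t ∈ Ico (0 : ℝ) 1, IsSelfAdjoint (k t))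
    (hw : ∀ t ∈ Ico (0 : ℝ) 1, ∀ v, Tendsto (fun n => inner ℂ v (W n t)) l (𝓝 (inner ℂ v (w t))))
    (y : E) {t : ℝ} (ht : t ∈ Ioo (0 : ℝ) 1) :
    HasDerivAt (fun s => inner ℂ (ρ (ρ y)) (w s)) (-Complex.I * inner ℂ y (k t (w t))) t := by
  have ht' := Ioo_subset_Ico_self ht
  have hnhds : Ico (0 : ℝ) 1 ∈ 𝓝 t := Ico_mem_nhds ht.1 ht.2
  have hmem : ∀ᶠ p in l ×ˢ 𝓝 t, p.2 ∈ Ioo (0 : ℝ) 1 :=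
    tendsto_snd.eventually (Ioo_mem_nhds ht.1 ht.2)
  have hJ := (tendsto_apply_apply_of_opNorm_le_one h.opNorm_le_one h.tendsto_apply y).mono_left hl
  have hkJ : Tendsto (fun p : ℕ × ℝ => k p.2 (J p.1 (J p.1 y))) (l ×ˢ 𝓝 t) (𝓝 (k t y)) :=
    (isBoundedBilinearMap_apply.continuous.tendsto (k t, y)).comp
      (((hk.continuousAt hnhds).tendsto.comp tendsto_snd).prodMk_nhds (hJ.comp tendsto_fst))
  have hlim := tendsto_inner_of_tendsto_of_norm_le
    (hmem.mono fun p hp => h.norm_le p.1 p.2 (Ioo_subset_Ico_self hp)) hkJ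
    (h.tendsto_inner_prod hρ hinj hΛ ht (hw t ht') _)
  refine hasDerivAt_of_tendsto_prod (f := fun n s => inner ℂ (ρ (ρ y)) (W n s))
    (f' := fun n s => -Complex.I * inner ℂ (J n (J n y)) (k s (W n s)))
    (hmem.mono fun p hp => (h.hasDerivWithinAt p.1 y p.2 (Ioo_subset_Ico_self hp)).hasDerivAt
      (Ico_mem_nhds hp.1 hp.2)) ?_ (mem_of_superset hnhds fun r hr => hw r hr _)
  rw [← (hsa t ht').isSymmetric.apply_clm]
  refine (hlim.const_mul _).congr' (hmem.mono fun p hp => ?_)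
  rw [(hsa p.2 (Ioo_subset_Ico_self hp)).isSymmetric.apply_clm]

end IsApproximateEvolution

namespace IsEvolutionData

variable [CompleteSpace E] {S : E →L[ℂ] E} {C β : ℝ}

theorem exists_opNorm_le (D : IsEvolutionData ρ S k C β) :
    ∃ Λ, ∀ t ∈ Ico (0 : ℝ) 1, ‖k t‖ ≤ Λ := by
  obtain ⟨L, hL⟩ := D.lipschitz
  refine ⟨‖k 0‖ + L, fun t ht => ?_⟩
  have hsub := hL.norm_sub_le ht (left_mem_Ico.mpr zero_lt_one)
  have ht1 : ‖t - 0‖ ≤ 1 := by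
    rw [sub_zero, Real.norm_of_nonneg ht.1]
    exact ht.2.le
  calc ‖k t‖ ≤ ‖k 0‖ + ‖k t - k 0‖ := norm_le_norm_add_norm_sub' _ _
    _ ≤ ‖k 0‖ + L * 1 := by grw [hsub, ht1]
    _ = ‖k 0‖ + L := by rw [mul_one]

theorem exists_isApproximateEvolution (D : IsEvolutionData ρ S k C β) (w₀ : E) :
    ∃ M J W, IsApproximateEvolution ρ k w₀ M J W ∧ ∀ n, ∀ t ∈ Ico (0 : ℝ) 1,
      defectForm ρ (W n t) ≤
        C * (C + C * β) * Real.exp ((C ^ 2 + C ^ 3) * t) * defectForm ρ w₀ := by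
  have hρ := D.selfAdjoint_left
  have hS := D.selfAdjoint_right
  have hε : ∀ n : ℕ, (0 : ℝ) < 1 / (n + 1) := fun n => Nat.one_div_pos_of_nat
  have hlim : Tendsto (fun n : ℕ => (1 : ℝ) / (n + 1)) atTop (𝓝[>] 0) :=
    tendsto_nhdsWithin_iff.mpr
      ⟨tendsto_one_div_add_atTop_nhds_zero_nat, Eventually.of_forall hε⟩
  have R := fun n => isRegularizer_tikhonovInverse hρ hS D.commute (hε n)
  choose W hW₀ hW hW_le using fun n => D.exists_regularized (R n) w₀
  set b := C * (C + C * β) * Real.exp (C ^ 2 + C ^ 3) * defectForm ρ w₀ with hb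
  refine ⟨√(2 * b), _, W, ⟨fun n => (R n).norm_mul_le_one, fun y => ?_, hW₀, fun n t ht => ?_, hW⟩,
    hW_le⟩
  · have hconv := tendsto_mul_tikhonovInverse_apply ((hρ.commute_iff hS).mp D.commute)
      (D.injective_left.comp D.injective_right) y
    simpa only [mul_assoc, Function.comp_def] using hconv.comp hlim
  · refine Real.le_sqrt_of_sq_le ((D.norm_sq_le_two_mul _).trans ?_)
    have hC := D.pos
    have hβ := D.bound_nonneg
    have hw₀ := D.defectForm_nonneg w₀
    grw [hW_le n t ht, hb, mul_le_of_le_one_right (by positivity) ht.2.le]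

theorem exists_isWeakEvolution (D : IsEvolutionData ρ S k C β) (w₀ : E) :
    ∃ w, w 0 = w₀ ∧ IsWeakEvolution ρ k w ∧ ∀ t ∈ Ico (0 : ℝ) 1, defectForm ρ (w t) ≤
      C * (C + C * β) * Real.exp ((C ^ 2 + C ^ 3) * t) * defectForm ρ w₀ := by
  have hρ := D.selfAdjoint_left
  obtain ⟨Λ, hΛ⟩ := D.exists_opNorm_le
  obtain ⟨L, hL⟩ := D.lipschitz
  obtain ⟨M, J, W, hW, hW_le⟩ := D.exists_isApproximateEvolution w₀
  choose! w hM hw using fun t ht => exists_weak_limit (hyperfilter ℕ)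
    (Eventually.of_forall fun n => hW.norm_le n t ht)
  have hU : ((hyperfilter ℕ : Ultrafilter ℕ) : Filter ℕ) ≤ atTop := Nat.hyperfilter_le_atTop
  refine ⟨w, ext_inner_left ℂ fun v => ?_, ⟨⟨M, hM⟩, ?_, fun y t ht => ?_⟩, fun t ht => ?_⟩
  · have hJ := tendsto_apply_apply_of_opNorm_le_one hW.opNorm_le_one hW.tendsto_apply w₀
    simp only [← hW.initial] at hJ
    exact tendsto_nhds_unique (hw 0 (by simp) v) (tendsto_const_nhds.inner (hJ.mono_left hU))
  · exact continuousOn_apply_of_norm_inner_sub_le hρ hM fun y t ht r hr =>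
      hW.norm_inner_sub_le_of_weak_limit hΛ hw y ht hr
  · exact hW.hasDerivAt_of_weak_limit hU hρ D.injective_left hΛ hL.continuousOn D.selfAdjoint hw
      y ht
  · exact defectForm_le_of_weak_limit hρ D.defectForm_nonneg (hw t ht) fun n => hW_le n t ht

end IsEvolutionData

end WeakEvolution

section DistributionalEvolution

variable {E : Type*} [NormedAddCommGroup E] [InnerProductSpace ℂ E] {a b M : ℝ}

theorem resolventForm_mul_self [CompleteSpace E] {ρ : E →L[ℂ] E} (hρ : IsSelfAdjoint ρ) (u : E) :
    resolventForm (ρ * ρ) u = defectForm ρ (ρ u) := by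
  rw [resolventForm, defectForm, inner_sub_right, Complex.sub_re, re_inner_self_eq_norm_sq,
    mul_apply_eq_comp, hρ.isSymmetric.apply_clm, re_inner_self_eq_norm_sq]

theorem neg_setIntegral_deriv_mul_I_eq_iff {U : Set ℝ} {φ : ℝ → ℝ} (hφ : IsTestFunction U φ)
    (g h : ℝ → ℂ) :
    -∫ t in U, ((deriv φ t : ℝ) : ℂ) * (Complex.I * g t) = ∫ t in U, (φ t : ℂ) * h t ↔
      ∫ t, deriv φ t • g t = -∫ t, φ t • (-Complex.I * h t) := by
  have hderiv : ∫ t in U, ((deriv φ t : ℝ) : ℂ) * (Complex.I * g t) =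
      Complex.I * ∫ t, deriv φ t • g t := by
    rw [← hφ.deriv.setIntegral_smul, ← integral_const_mul]
    simp only [Complex.real_smul, mul_left_comm]
  have hmul : ∫ t, φ t • (-Complex.I * h t) = -Complex.I * ∫ t in U, (φ t : ℂ) * h t := by
    rw [← hφ.setIntegral_smul, ← integral_const_mul]
    simp only [Complex.real_smul, mul_left_comm]
  rw [hderiv, hmul, neg_mul, neg_neg, ← mul_right_inj' Complex.I_ne_zero, mul_neg, ← mul_assoc,
    Complex.I_mul_I, neg_one_mul, neg_neg]

theorem neBot_nhdsWithin_of_ae_Ioo (hab : a ≠ b) {p : ℝ → Prop}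
    (hp : ∀ᵐ t ∂(volume.restrict (Ioo a b)), p t) {t : ℝ} (ht : t ∈ Icc a b) :
    (𝓝[Ioo a b ∩ {s | s ∈ Ioo a b → p s}] t).NeBot := by
  have hdense : Dense {s | s ∈ Ioo a b → p s} :=
    Measure.dense_of_ae ((ae_restrict_iff' measurableSet_Ioo).mp hp)
  rw [← closure_Ioo hab] at ht
  exact mem_closure_iff_nhdsWithin_neBot.mp
    (closure_minimal (hdense.open_subset_closure_inter isOpen_Ioo) isClosed_closure ht)

variable [CompleteSpace E]

theorem exists_apply_eq_of_ae_Ioo {T : E →L[ℂ] E} {x ζ : ℝ → E} (hab : a ≠ b)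
    (hx : ContinuousOn x (Ico a b)) (hζ : ∀ᵐ t ∂(volume.restrict (Ioo a b)), T (ζ t) = x t)
    (hM : ∀ᵐ t ∂(volume.restrict (Ioo a b)), ‖ζ t‖ ≤ M) {t : ℝ} (ht : t ∈ Ico a b) :
    ∃ w, T w = x t ∧ ‖w‖ ≤ M := by
  have := neBot_nhdsWithin_of_ae_Ioo hab (hζ.and hM) (Ico_subset_Icc_self ht)
  set G := Ioo a b ∩ {s | s ∈ Ioo a b → T (ζ s) = x s ∧ ‖ζ s‖ ≤ M}
  have hG : G ⊆ Ico a b := inter_subset_left.trans Ioo_subset_Ico_self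
  have hlim : Tendsto (fun s => T (ζ s)) (𝓝[G] t) (𝓝 (x t)) :=
    ((hx t ht).mono_left (nhdsWithin_mono t hG)).congr'
      (eventually_nhdsWithin_of_forall fun s hs => (hs.2 hs.1).1.symm)
  exact exists_apply_eq_of_tendsto
    (eventually_nhdsWithin_of_forall fun s hs => (hs.2 hs.1).2) hlim

variable {ρ : E →L[ℂ] E} {k : ℝ → E →L[ℂ] E} {w x ζ : ℝ → E}

theorem isWeakEvolution_of_distributional (hρ : IsSelfAdjoint ρ) (hinj : Function.Injective ρ)
    (hk : ContinuousOn k (Ico 0 1)) (hsa : ∀ t ∈ Ico (0 : ℝ) 1, IsSelfAdjoint (k t))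
    (hM : ∀ t ∈ Ico (0 : ℝ) 1, ‖w t‖ ≤ M) (hρw : ContinuousOn (fun t => ρ (w t)) (Ico 0 1))
    (heq : ∀ y (φ : ℝ → ℝ), IsTestFunction (Ioo 0 1) φ →
      -∫ t in Ioo (0 : ℝ) 1, ((deriv φ t : ℝ) : ℂ) * (Complex.I * inner ℂ (ρ y) (ρ (w t))) =
        ∫ t in Ioo (0 : ℝ) 1, (φ t : ℂ) * inner ℂ y (k t (w t))) : IsWeakEvolution ρ k w := by
  have hweak := continuousOn_inner_of_continuousOn_apply hρ hinj hM hρw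
  refine ⟨⟨M, hM⟩, hρw, fun y t ht => hasDerivAt_of_integral_deriv_smul_eq_neg
    (g' := fun t => -Complex.I * inner ℂ y (k t (w t)))
    ((hweak _).mono Ioo_subset_Ico_self) (continuousOn_const.mul
      ((continuousOn_inner_clm_apply hk hsa hM hweak y).mono Ioo_subset_Ico_self))
    (fun φ hφ => ?_) ht⟩
  simp only [hρ.isSymmetric.apply_clm (ρ y)]
  exact (neg_setIntegral_deriv_mul_I_eq_iff hφ _ _).mp (heq y φ hφ)

theorem IsWeakEvolution.distributional (h : IsWeakEvolution ρ k w) (hρ : IsSelfAdjoint ρ)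
    (hinj : Function.Injective ρ) (hk : ContinuousOn k (Ico 0 1))
    (hsa : ∀ t ∈ Ico (0 : ℝ) 1, IsSelfAdjoint (k t)) (y : E) {φ : ℝ → ℝ}
    (hφ : IsTestFunction (Ioo 0 1) φ) :
    -∫ t in Ioo (0 : ℝ) 1, ((deriv φ t : ℝ) : ℂ) * (Complex.I * inner ℂ (ρ y) (ρ (w t))) =
      ∫ t in Ioo (0 : ℝ) 1, (φ t : ℂ) * inner ℂ y (k t (w t)) := by
  obtain ⟨M, hM⟩ := h.exists_norm_le
  have hweak := continuousOn_inner_of_continuousOn_apply hρ hinj hM h.continuousOn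
  rw [neg_setIntegral_deriv_mul_I_eq_iff hφ]
  simp only [← hρ.isSymmetric.apply_clm (ρ y)]
  exact hφ.integral_deriv_smul_eq_neg isOpen_Ioo (h.hasDerivAt y) (continuousOn_const.mul
    ((continuousOn_inner_clm_apply hk hsa hM hweak y).mono Ioo_subset_Ico_self))

theorem exists_isWeakEvolution_of_distributional_ae (hρ : IsSelfAdjoint ρ)
    (hinj : Function.Injective ρ) (hk : ContinuousOn k (Ico 0 1))
    (hsa : ∀ t ∈ Ico (0 : ℝ) 1, IsSelfAdjoint (k t)) (hx : ContinuousOn x (Ico 0 1))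
    (hζ : ∀ᵐ t ∂(volume.restrict (Ioo (0 : ℝ) 1)), ρ (ζ t) = x t)
    (hM : ∀ᵐ t ∂(volume.restrict (Ioo (0 : ℝ) 1)), ‖ζ t‖ ≤ M)
    (heq : ∀ y (φ : ℝ → ℝ), IsTestFunction (Ioo 0 1) φ →
      -∫ t in Ioo (0 : ℝ) 1, ((deriv φ t : ℝ) : ℂ) * (Complex.I * inner ℂ (ρ y) (ρ (ζ t))) =
        ∫ t in Ioo (0 : ℝ) 1, (φ t : ℂ) * inner ℂ y (k t (ζ t))) :
    ∃ w, (∀ t ∈ Ico (0 : ℝ) 1, ρ (w t) = x t) ∧ IsWeakEvolution ρ k w := by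
  choose! w hw hwM using fun t (ht : t ∈ Ico (0 : ℝ) 1) =>
    exists_apply_eq_of_ae_Ioo zero_ne_one hx hζ hM ht
  have hae : ∀ᵐ t ∂(volume.restrict (Ioo (0 : ℝ) 1)), ζ t = w t := by
    filter_upwards [hζ, ae_restrict_mem measurableSet_Ioo] with t ht htI
    exact hinj (ht.trans (hw t (Ioo_subset_Ico_self htI)).symm)
  refine ⟨w, hw, isWeakEvolution_of_distributional hρ hinj hk hsa hwM (hx.congr hw)
    fun y φ hφ => ?_⟩
  convert heq y φ hφ using 1
  · exact congrArg Neg.neg (integral_congr_ae (hae.mono fun t ht => by simp only [ht]))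
  · exact integral_congr_ae (hae.mono fun t ht => by simp only [ht])

end DistributionalEvolution

section FormDomain

theorem tendsto_sub_prod_atTop {F : Type*} [AddGroup F] [TopologicalSpace F]
    [IsTopologicalAddGroup F] {v : ℕ → F} {x : F} (hv : Tendsto v atTop (𝓝 x)) :
    Tendsto (fun p : ℕ × ℕ => v p.1 - v p.2) atTop (𝓝 0) := by
  rw [← sub_self x, ← prod_atTop_atTop_eq]
  exact (hv.comp tendsto_fst).sub (hv.comp tendsto_snd)

namespace PosSelfAdjoint

variable {E : Type*} [NormedAddCommGroup E] [InnerProductSpace ℂ E] [CompleteSpace E]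
  {T : PosSelfAdjoint E} {R ρ : E →L[ℂ] E}

theorem inner_op_comm (T : PosSelfAdjoint E) (x y : T.op.domain) :
    inner ℂ (T.op x) (y : E) = inner ℂ (x : E) (T.op y) := by
  have h := LinearPMap.adjoint_isFormalAdjoint (T := T.op) T.isSelfAdjoint.dense_domain
  rw [LinearPMap.isSelfAdjoint_def.mp T.isSelfAdjoint] at h
  exact h x y

theorem isFormApprox_const (x : T.op.domain) : T.IsFormApprox x fun _ => x := by
  simp [IsFormApprox, energy]

theorem form_of_mem_domain (x : T.op.domain) (hx : (x : E) ∈ T.formDomain) :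
    T.form ⟨x, hx⟩ = T.energy x :=
  tendsto_nhds_unique (T.tendsto_form ⟨x, hx⟩ (isFormApprox_const x)) tendsto_const_nhds

theorem form_nonneg (T : PosSelfAdjoint E) (x : T.formDomain) : 0 ≤ T.form x := by
  obtain ⟨u, hu⟩ := x.2
  exact ge_of_tendsto' (T.tendsto_form x hu) fun n => T.nonneg _

theorem form_smul (T : PosSelfAdjoint E) (c : ℂ) (x : T.formDomain) :
    T.form (c • x) = ‖c‖ ^ 2 * T.form x := by
  obtain ⟨u, hu⟩ := x.2
  have happrox : T.IsFormApprox (c • x : T.formDomain) fun n => c • u n :=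
    ⟨hu.1.const_smul c, by
      simpa only [← smul_sub, energy_smul, mul_zero] using hu.2.const_mul (‖c‖ ^ 2)⟩
  have hlim := T.tendsto_form (c • x) happrox
  simp only [energy_smul] at hlim
  exact tendsto_nhds_unique hlim ((T.tendsto_form x hu).const_mul _)

namespace IsResolvent

theorem mem_domain (hR : T.IsResolvent R) (u : E) : R u ∈ T.op.domain := (hR.1 u).1

theorem op_apply (hR : T.IsResolvent R) (u : E) : T.op ⟨R u, hR.mem_domain u⟩ = u - R u :=
  eq_sub_of_add_eq (hR.1 u).2

theorem isSelfAdjoint (hR : T.IsResolvent R) : IsSelfAdjoint R := by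
  rw [ContinuousLinearMap.isSelfAdjoint_iff_isSymmetric]
  intro x y
  have h := T.inner_op_comm ⟨R x, hR.mem_domain x⟩ ⟨R y, hR.mem_domain y⟩
  rw [hR.op_apply, hR.op_apply, inner_sub_left, inner_sub_right] at h
  simpa using h.symm

theorem injective (hR : T.IsResolvent R) : Function.Injective R := by
  rw [injective_iff_map_eq_zero]
  intro x hx
  have hop := hR.op_apply x
  have hzero : (⟨R x, hR.mem_domain x⟩ : T.op.domain) = 0 := Subtype.ext hx
  rw [hzero, LinearPMap.map_zero, hx, sub_zero] at hop
  exact hop.symm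

theorem energy_eq (hR : T.IsResolvent R) (u : E) :
    T.energy ⟨R u, hR.mem_domain u⟩ = resolventForm R u := by
  rw [energy, hR.op_apply, resolventForm]

theorem form_eq (hR : T.IsResolvent R) (u : E) (hu : R u ∈ T.formDomain) :
    T.form ⟨R u, hu⟩ = resolventForm R u :=
  (form_of_mem_domain ⟨R u, hR.mem_domain u⟩ hu).trans (hR.energy_eq u)

theorem resolventForm_nonneg (hR : T.IsResolvent R) (u : E) : 0 ≤ resolventForm R u :=
  hR.energy_eq u ▸ T.nonneg _

theorem nonneg (hR : T.IsResolvent R) : 0 ≤ R := by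
  refine nonneg_of_isSelfAdjoint_of_re_inner_nonneg hR.isSelfAdjoint fun u => ?_
  have h := hR.resolventForm_nonneg u
  rw [resolventForm, inner_sub_right, Complex.sub_re, re_inner_self_eq_norm_sq,
    hR.isSelfAdjoint.isSymmetric.apply_clm] at h
  linarith [sq_nonneg ‖R u‖]

end IsResolvent

/-- The operator `T + 1` on the domain of `T`. -/
noncomputable def addOne (T : PosSelfAdjoint E) : T.op.domain →ₗ[ℂ] E :=
  T.op.toFun + T.op.domain.subtype

/-- `ρ` is the self-adjoint square root `(T + 1)^(-1/2)` of the resolvent. It identifies the Hilbert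
space with the form domain `Q(T)`, see `formDomainEquiv`; its sign is immaterial. -/
structure IsSqrtResolvent (T : PosSelfAdjoint E) (ρ : E →L[ℂ] E) : Prop where
  isSelfAdjoint : IsSelfAdjoint ρ
  isResolvent_mul_self : T.IsResolvent (ρ * ρ)

theorem IsResolvent.isSqrtResolvent_sqrt (hR : T.IsResolvent R) :
    T.IsSqrtResolvent (CFC.sqrt R) where
  isSelfAdjoint := (CFC.sqrt_nonneg R).isSelfAdjoint
  isResolvent_mul_self := by rwa [CFC.sqrt_mul_sqrt_self R hR.nonneg]

namespace IsSqrtResolvent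

theorem injective (hρ : T.IsSqrtResolvent ρ) : Function.Injective ρ :=
  Function.Injective.of_comp (f := ρ) hρ.isResolvent_mul_self.injective

theorem denseRange (hρ : T.IsSqrtResolvent ρ) : DenseRange ρ :=
  denseRange_of_isSelfAdjoint_of_injective hρ.isSelfAdjoint hρ.injective

theorem apply_apply_addOne (hρ : T.IsSqrtResolvent ρ) (x : T.op.domain) :
    ρ (ρ (T.addOne x)) = x :=
  hρ.isResolvent_mul_self.2 x

theorem addOne_apply_apply (hρ : T.IsSqrtResolvent ρ) (u : E) :
    T.addOne ⟨ρ (ρ u), hρ.isResolvent_mul_self.mem_domain u⟩ = u :=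
  (hρ.isResolvent_mul_self.1 u).2

theorem energy_eq (hρ : T.IsSqrtResolvent ρ) (x : T.op.domain) :
    T.energy x = defectForm ρ (ρ (T.addOne x)) := by
  have hx : (⟨(ρ * ρ) (T.addOne x), hρ.isResolvent_mul_self.mem_domain _⟩ : T.op.domain) = x :=
    Subtype.ext (hρ.apply_apply_addOne x)
  have henergy := hρ.isResolvent_mul_self.energy_eq (T.addOne x)
  rwa [hx, resolventForm_mul_self hρ.isSelfAdjoint] at henergy

theorem isFormApprox_of_tendsto (hρ : T.IsSqrtResolvent ρ) {w : E} {u : ℕ → T.op.domain}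
    (hu : Tendsto (fun n => ρ (T.addOne (u n))) atTop (𝓝 w)) : T.IsFormApprox (ρ w) u := by
  constructor
  · simpa only [Function.comp_def, hρ.apply_apply_addOne] using (ρ.continuous.tendsto w).comp hu
  · have hdefect : Tendsto (defectForm ρ) (𝓝 0) (𝓝 0) := by
      simpa [defectForm] using (continuous_defectForm ρ).tendsto 0
    simpa only [Function.comp_def, hρ.energy_eq, map_sub] using
      hdefect.comp (tendsto_sub_prod_atTop hu)

theorem exists_tendsto (hρ : T.IsSqrtResolvent ρ) (w : E) :
    ∃ u : ℕ → T.op.domain, Tendsto (fun n => ρ (T.addOne (u n))) atTop (𝓝 w) := by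
  obtain ⟨v, hv, hlim⟩ := mem_closure_iff_seq_limit.mp (hρ.denseRange w)
  choose v' hv' using hv
  refine ⟨fun n => ⟨ρ (ρ (v' n)), hρ.isResolvent_mul_self.mem_domain _⟩, hlim.congr fun n => ?_⟩
  rw [hρ.addOne_apply_apply, hv']

theorem apply_mem_formDomain (hρ : T.IsSqrtResolvent ρ) (w : E) : ρ w ∈ T.formDomain := by
  obtain ⟨u, hu⟩ := hρ.exists_tendsto w
  exact ⟨u, hρ.isFormApprox_of_tendsto hu⟩

theorem form_apply (hρ : T.IsSqrtResolvent ρ) (w : E) :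
    T.form ⟨ρ w, hρ.apply_mem_formDomain w⟩ = defectForm ρ w := by
  obtain ⟨u, hu⟩ := hρ.exists_tendsto w
  refine tendsto_nhds_unique (T.tendsto_form _ (hρ.isFormApprox_of_tendsto hu)) ?_
  simpa only [Function.comp_def, hρ.energy_eq] using ((continuous_defectForm ρ).tendsto w).comp hu

theorem dist_sqrt_addOne (hρ : T.IsSqrtResolvent ρ) (x y : T.op.domain) :
    dist (ρ (T.addOne x)) (ρ (T.addOne y)) = √(T.energy (x - y) + ‖(x : E) - y‖ ^ 2) := by
  rw [hρ.energy_eq, defectForm, hρ.apply_apply_addOne, Submodule.coe_sub, sub_add_cancel,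
    Real.sqrt_sq (norm_nonneg _), dist_eq_norm, map_sub, map_sub]

theorem exists_apply_eq (hρ : T.IsSqrtResolvent ρ) {x : E} (hx : x ∈ T.formDomain) :
    ∃ w, ρ w = x := by
  obtain ⟨u, hu, hu'⟩ := hx
  have hcauchy : CauchySeq fun n => ρ (T.addOne (u n)) := by
    rw [cauchySeq_iff_tendsto_dist_atTop_0]
    simpa only [hρ.dist_sqrt_addOne, norm_zero, ne_eq, OfNat.ofNat_ne_zero, not_false_eq_true,
      zero_pow, add_zero, Real.sqrt_zero] using
      (hu'.add ((tendsto_sub_prod_atTop hu).norm.pow 2)).sqrt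
  obtain ⟨w, hw⟩ := cauchySeq_tendsto_of_complete hcauchy
  refine ⟨w, tendsto_nhds_unique ((ρ.continuous.tendsto w).comp hw) ?_⟩
  simpa only [Function.comp_def, hρ.apply_apply_addOne] using hu

/-- The identification `w ↦ (T + 1)^(-1/2) w` of the Hilbert space with the form domain. -/
noncomputable def formDomainEquiv (hρ : T.IsSqrtResolvent ρ) : E ≃ₗ[ℂ] T.formDomain :=
  LinearEquiv.ofBijective
    ((ρ : E →ₗ[ℂ] E).codRestrict T.formDomain hρ.apply_mem_formDomain)
    ⟨fun _ _ h => hρ.injective (congrArg Subtype.val h), fun x => by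
      obtain ⟨w, hw⟩ := hρ.exists_apply_eq x.2
      exact ⟨w, Subtype.ext hw⟩⟩

theorem coe_formDomainEquiv (hρ : T.IsSqrtResolvent ρ) (w : E) :
    (hρ.formDomainEquiv w : E) = ρ w := rfl

theorem apply_formDomainEquiv_symm (hρ : T.IsSqrtResolvent ρ) (x : T.formDomain) :
    ρ (hρ.formDomainEquiv.symm x) = x := by
  rw [← hρ.coe_formDomainEquiv, LinearEquiv.apply_symm_apply]

theorem form_formDomainEquiv (hρ : T.IsSqrtResolvent ρ) (w : E) :
    T.form (hρ.formDomainEquiv w) = defectForm ρ w :=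
  hρ.form_apply w

theorem form_formDomainEquiv_le (hρ : T.IsSqrtResolvent ρ) (w : E) :
    T.form (hρ.formDomainEquiv w) ≤ ‖w‖ ^ 2 :=
  (hρ.form_formDomainEquiv w).trans_le (sub_le_self _ (sq_nonneg _))

theorem norm_sq_le_defectForm (hρ : T.IsSqrtResolvent ρ)
    (hT : ∀ x : T.op.domain, ‖(x : E)‖ ^ 2 ≤ (inner ℂ (x : E) (T.op x)).re) (w : E) :
    ‖ρ w‖ ^ 2 ≤ defectForm ρ w := by
  refine hρ.denseRange.induction_on (p := fun w => ‖ρ w‖ ^ 2 ≤ defectForm ρ w) w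
    (isClosed_le (by fun_prop) (continuous_defectForm ρ)) fun v => ?_
  rw [← resolventForm_mul_self hρ.isSelfAdjoint, ← hρ.isResolvent_mul_self.energy_eq]
  exact hT ⟨(ρ * ρ) v, hρ.isResolvent_mul_self.mem_domain v⟩

end IsSqrtResolvent

end PosSelfAdjoint

end FormDomain

section RelativeBound

namespace PosSelfAdjoint

variable {E : Type*} [NormedAddCommGroup E] [InnerProductSpace ℂ E] [CompleteSpace E]
  {A B : PosSelfAdjoint E} {ρ σ : E →L[ℂ] E}

theorem exists_sqrt_factorization (hρ : A.IsSqrtResolvent ρ) (hσ : B.IsSqrtResolvent σ)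
    (hQ : A.formDomain ≤ B.formDomain) : ∃ G : E →L[ℂ] E, ∀ w, σ (G w) = ρ w := by
  let G : E →ₗ[ℂ] E :=
    hσ.formDomainEquiv.symm ∘ₗ Submodule.inclusion hQ ∘ₗ hρ.formDomainEquiv
  have hG : ∀ w, σ (G w) = ρ w := fun w => hσ.apply_formDomainEquiv_symm _
  have hcont : Continuous G := by
    refine G.continuous_of_seq_closed_graph fun u x y hu hGu => hσ.injective ?_
    rw [hG]
    refine tendsto_nhds_unique ((σ.continuous.tendsto y).comp hGu) ?_
    simpa only [Function.comp_def, hG] using (ρ.continuous.tendsto x).comp hu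
  exact ⟨⟨G, hcont⟩, hG⟩

theorem exists_form_le_mul_form (hρ : A.IsSqrtResolvent ρ)
    (hA : ∀ x : A.op.domain, ‖(x : E)‖ ^ 2 ≤ (inner ℂ (x : E) (A.op x)).re)
    (hσ : B.IsSqrtResolvent σ) (hQ : A.formDomain ≤ B.formDomain) :
    ∃ c : ℝ, 0 ≤ c ∧ ∀ x, B.form (Submodule.inclusion hQ x) ≤ c * A.form x := by
  obtain ⟨G, hG⟩ := exists_sqrt_factorization hρ hσ hQ
  refine ⟨2 * ‖G‖ ^ 2, by positivity, fun x => ?_⟩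
  obtain ⟨w, rfl⟩ := hρ.formDomainEquiv.surjective x
  have hincl : Submodule.inclusion hQ (hρ.formDomainEquiv w) = hσ.formDomainEquiv (G w) :=
    Subtype.ext (hG w).symm
  have hnorm : ‖w‖ ^ 2 ≤ 2 * defectForm ρ w := by
    have := hρ.norm_sq_le_defectForm hA w
    unfold defectForm at this ⊢
    linarith
  rw [hincl, hρ.form_formDomainEquiv]
  calc B.form (hσ.formDomainEquiv (G w)) ≤ ‖G w‖ ^ 2 := hσ.form_formDomainEquiv_le (G w)
    _ ≤ (‖G‖ * ‖w‖) ^ 2 := by gcongr; exact G.le_opNorm w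
    _ = ‖G‖ ^ 2 * ‖w‖ ^ 2 := mul_pow _ _ _
    _ ≤ ‖G‖ ^ 2 * (2 * defectForm ρ w) := by gcongr
    _ = 2 * ‖G‖ ^ 2 * defectForm ρ w := by ring

theorem relFormBound_nonneg (hQ : A.formDomain ≤ B.formDomain) : 0 ≤ A.relFormBound B hQ := by
  refine Real.sSup_nonneg ?_
  rintro _ ⟨x, _, rfl⟩
  exact B.form_nonneg _

theorem form_le_relFormBound_mul {c : ℝ} (hQ : A.formDomain ≤ B.formDomain) (hc0 : 0 ≤ c)
    (hc : ∀ x, B.form (Submodule.inclusion hQ x) ≤ c * A.form x) (x : A.formDomain) :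
    B.form (Submodule.inclusion hQ x) ≤ A.relFormBound B hQ * A.form x := by
  have hbdd : BddAbove {r | ∃ x : A.formDomain, A.form x ≤ 1 ∧
      r = B.form (Submodule.inclusion hQ x)} := by
    refine ⟨c, ?_⟩
    rintro _ ⟨x, hx, rfl⟩
    exact (hc x).trans (mul_le_of_le_one_right hc0 hx)
  rcases (A.form_nonneg x).eq_or_lt with hzero | hpos
  · simpa only [← hzero, mul_zero] using hc x
  · set a : ℝ := (√(A.form x))⁻¹
    have ha : ‖(a : ℂ)‖ ^ 2 = (A.form x)⁻¹ := by
      rw [Complex.norm_real, Real.norm_eq_abs, sq_abs, inv_pow, Real.sq_sqrt hpos.le]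
    have hunit : A.form ((a : ℂ) • x) = 1 := by
      rw [form_smul, ha, inv_mul_cancel₀ hpos.ne']
    have hsup : B.form (Submodule.inclusion hQ ((a : ℂ) • x)) ≤ A.relFormBound B hQ :=
      le_csSup hbdd ⟨_, hunit.le, rfl⟩
    rwa [map_smul, form_smul, ha, inv_mul_le_iff₀ hpos, mul_comm] at hsup

end PosSelfAdjoint

end RelativeBound

section FormFamily

namespace PosSelfAdjoint

variable {E : Type*} [NormedAddCommGroup E] [InnerProductSpace ℂ E] [CompleteSpace E]
  {A B : PosSelfAdjoint E} {hQ : A.formDomain ≤ B.formDomain}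
  {H : ℝ → A.formDomain →ₗ⋆[ℂ] A.formDomain →ₗ[ℂ] ℂ} {C : ℝ}
  {ρ S : E →L[ℂ] E} {k : ℝ → E →L[ℂ] E}

/-- The hypotheses of the theorem on the time-dependent forms `H(t)`: they are symmetric,
`C⁻¹ A - C B ≤ H(t) ≤ C A`, `i [H(t), B] ≤ C A`, and `± Ḣ(t) ≤ C A`. -/
structure IsControlledFamily (A B : PosSelfAdjoint E) (hQ : A.formDomain ≤ B.formDomain)
    (H : ℝ → A.formDomain →ₗ⋆[ℂ] A.formDomain →ₗ[ℂ] ℂ) (C : ℝ) : Prop where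
  symm : ∀ t ∈ Ico (0 : ℝ) 1, ∀ x y : A.formDomain, H t x y = conj (H t y x)
  upper : ∀ t ∈ Ico (0 : ℝ) 1, ∀ x : A.formDomain, (H t x x).re ≤ C * A.form x
  lower : ∀ t ∈ Ico (0 : ℝ) 1, ∀ x : A.formDomain,
    C⁻¹ * A.form x - C * B.form (Submodule.inclusion hQ x) ≤ (H t x x).re
  commutator : ∀ t ∈ Ico (0 : ℝ) 1, ∀ (x : A.formDomain) (hx : (x : E) ∈ B.op.domain)
    (hBx : B.op ⟨x, hx⟩ ∈ A.formDomain),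
    (Complex.I * (H t x ⟨B.op ⟨x, hx⟩, hBx⟩ - H t ⟨B.op ⟨x, hx⟩, hBx⟩ x)).re ≤ C * A.form x
  deriv : ∀ t ∈ Ico (0 : ℝ) 1, ∀ x : A.formDomain, ∃ d : ℝ,
    HasDerivWithinAt (fun s => (H s x x).re) d (Ico 0 1) t ∧
      -(C * A.form x) ≤ d ∧ d ≤ C * A.form x

/-- The bounded self-adjoint operators `k(t)` are the forms `H(t)`, transported from `Q(A)` to the
Hilbert space along `(A + 1)^(-1/2)`. -/
structure Represents (hρ : A.IsSqrtResolvent ρ)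
    (H : ℝ → A.formDomain →ₗ⋆[ℂ] A.formDomain →ₗ[ℂ] ℂ) (k : ℝ → E →L[ℂ] E) : Prop where
  isSelfAdjoint : ∀ t ∈ Ico (0 : ℝ) 1, IsSelfAdjoint (k t)
  inner_apply : ∀ t ∈ Ico (0 : ℝ) 1, ∀ w v,
    inner ℂ w (k t v) = H t (hρ.formDomainEquiv w) (hρ.formDomainEquiv v)

theorem IsControlledFamily.abs_re_le (hH : IsControlledFamily A B hQ H C) (hC : 0 < C) {b t : ℝ}
    (hb0 : 0 ≤ b) (hb : ∀ x, B.form (Submodule.inclusion hQ x) ≤ b * A.form x)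
    (ht : t ∈ Ico (0 : ℝ) 1) (x : A.formDomain) :
    |(H t x x).re| ≤ (C + C * b) * A.form x := by
  have hA := A.form_nonneg x
  have hCB : C * B.form (Submodule.inclusion hQ x) ≤ C * (b * A.form x) := by grw [hb x]
  have hCA : 0 ≤ C⁻¹ * A.form x := by positivity
  have hCb : 0 ≤ C * (b * A.form x) := by positivity
  rw [abs_le]
  constructor
  · linarith [hH.lower t ht x, mul_nonneg hC.le hA]
  · linarith [hH.upper t ht x]

theorem IsControlledFamily.exists_represents (hH : IsControlledFamily A B hQ H C) (hC : 0 < C)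
    (hρ : A.IsSqrtResolvent ρ) {b : ℝ} (hb0 : 0 ≤ b)
    (hb : ∀ x, B.form (Submodule.inclusion hQ x) ≤ b * A.form x) :
    ∃ k, Represents hρ H k := by
  have hop : ∀ t ∈ Ico (0 : ℝ) 1, ∃ T : E →L[ℂ] E, IsSelfAdjoint T ∧
      ∀ w v, inner ℂ w (T v) = H t (hρ.formDomainEquiv w) (hρ.formDomainEquiv v) := by
    intro t ht
    refine exists_isSelfAdjoint_of_sesq (c := C + C * b)
      (q := ((H t).comp hρ.formDomainEquiv.toLinearMap).compl₂ hρ.formDomainEquiv.toLinearMap)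
      (fun w v => hH.symm t ht _ _) fun w => (hH.abs_re_le hC hb0 hb ht _).trans ?_
    have hCb : 0 ≤ C + C * b := by positivity
    exact mul_le_mul_of_nonneg_left (hρ.form_formDomainEquiv_le w) hCb
  choose! k hk hkH using hop
  exact ⟨k, hk, hkH⟩

namespace Represents

variable {hρ : A.IsSqrtResolvent ρ}

theorem lipschitzOnWith (hk : Represents hρ H k) (hC : 0 < C)
    (hH : IsControlledFamily A B hQ H C) : LipschitzOnWith C.toNNReal k (Ico 0 1) := by
  refine LipschitzOnWith.of_dist_le_mul fun s hs t ht => ?_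
  rw [dist_eq_norm, Real.coe_toNNReal _ hC.le, Real.dist_eq]
  refine norm_le_of_abs_re_inner_self_le ((hk.isSelfAdjoint s hs).sub (hk.isSelfAdjoint t ht))
    (by positivity) fun w => ?_
  set x := hρ.formDomainEquiv w
  have hle : A.form x ≤ ‖w‖ ^ 2 := hρ.form_formDomainEquiv_le w
  choose! d hd hd_neg hd_le using fun r hr => hH.deriv r hr x
  have hmean := (convex_Ico (0 : ℝ) 1).norm_image_sub_le_of_norm_hasDerivWithin_le
    (C := C * A.form x) hd (fun r hr => abs_le.mpr ⟨hd_neg r hr, hd_le r hr⟩) ht hs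
  rw [Real.norm_eq_abs, Real.norm_eq_abs] at hmean
  rw [sub_apply, inner_sub_right, Complex.sub_re, hk.inner_apply s hs, hk.inner_apply t ht,
    mul_right_comm]
  exact hmean.trans (by gcongr)

theorem commutator_le (hk : Represents hρ H k) (hH : IsControlledFamily A B hQ H C)
    (hS : B.IsResolvent S) {t : ℝ} (ht : t ∈ Ico (0 : ℝ) 1) {w u w' : E} (hwu : ρ w = S u)
    (hw' : ρ w' = u - S u) :
    (Complex.I * (inner ℂ w (k t w') - inner ℂ w' (k t w))).re ≤ C * defectForm ρ w := by
  set x := hρ.formDomainEquiv w with hx_def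
  have hxu : (x : E) = S u := hwu
  have hx : (x : E) ∈ B.op.domain := hxu ▸ hS.mem_domain u
  have hBx : B.op ⟨x, hx⟩ = hρ.formDomainEquiv w' :=
    calc B.op ⟨x, hx⟩ = B.op ⟨S u, hS.mem_domain u⟩ := congrArg B.op (Subtype.ext hxu)
      _ = u - S u := hS.op_apply u
      _ = hρ.formDomainEquiv w' := hw'.symm
  have hBx_mem : B.op ⟨x, hx⟩ ∈ A.formDomain := hBx ▸ (hρ.formDomainEquiv w').2
  have hcomm := hH.commutator t ht x hx hBx_mem
  rwa [show (⟨B.op ⟨x, hx⟩, hBx_mem⟩ : A.formDomain) = hρ.formDomainEquiv w' from Subtype.ext hBx,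
    hx_def, ← hk.inner_apply t ht, ← hk.inner_apply t ht, hρ.form_formDomainEquiv] at hcomm

theorem exists_hasDerivWithinAt (hk : Represents hρ H k) (hH : IsControlledFamily A B hQ H C)
    {t : ℝ} (ht : t ∈ Ico (0 : ℝ) 1) (w : E) : ∃ d : ℝ,
    HasDerivWithinAt (fun s => (inner ℂ w (k s w)).re) d (Ico 0 1) t ∧ d ≤ C * defectForm ρ w := by
  obtain ⟨d, hd, -, hd_le⟩ := hH.deriv t ht (hρ.formDomainEquiv w)
  refine ⟨d, hd.congr_of_mem (fun s hs => ?_) ht, hρ.form_formDomainEquiv w ▸ hd_le⟩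
  rw [hk.inner_apply s hs]

theorem isEvolutionData (hk : Represents hρ H k) (hC : 0 < C)
    (hA : ∀ x : A.op.domain, ‖(x : E)‖ ^ 2 ≤ (inner ℂ (x : E) (A.op x)).re)
    (hS : B.IsResolvent S) (hρS : Commute ρ S) (hH : IsControlledFamily A B hQ H C)
    {b : ℝ} (hb0 : 0 ≤ b) (hb : ∀ x, B.form (Submodule.inclusion hQ x) ≤ b * A.form x) :
    IsEvolutionData ρ S k C b := by
  have hB : ∀ {w u}, ρ w = S u →
      B.form (Submodule.inclusion hQ (hρ.formDomainEquiv w)) = resolventForm S u := by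
    intro w u hwu
    rw [← hS.form_eq u (hwu ▸ hQ (hρ.apply_mem_formDomain w))]
    exact congrArg B.form (Subtype.ext hwu)
  exact
    { selfAdjoint_left := hρ.isSelfAdjoint
      injective_left := hρ.injective
      selfAdjoint_right := hS.isSelfAdjoint
      injective_right := hS.injective
      commute := hρS
      norm_sq_le := hρ.norm_sq_le_defectForm hA
      resolventForm_nonneg := hS.resolventForm_nonneg
      pos := hC
      bound_nonneg := hb0
      lipschitz := ⟨_, hk.lipschitzOnWith hC hH⟩
      selfAdjoint := hk.isSelfAdjoint
      upper := fun t ht w => by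
        rw [hk.inner_apply t ht, ← hρ.form_formDomainEquiv]
        exact hH.upper t ht _
      lower := fun t ht w u hwu => by
        rw [hk.inner_apply t ht, ← hρ.form_formDomainEquiv, ← hB hwu]
        exact hH.lower t ht _
      relative := fun w u hwu => by
        rw [← hρ.form_formDomainEquiv, ← hB hwu]
        exact hb _
      commutator := fun t ht w u w' => hk.commutator_le hH hS ht
      deriv_le := fun t ht => hk.exists_hasDerivWithinAt hH ht }

end Represents

theorem IsControlledFamily.exists_isEvolutionData (hH : IsControlledFamily A B hQ H C)
    (hC : 0 < C) (hA : ∀ x : A.op.domain, ‖(x : E)‖ ^ 2 ≤ (inner ℂ (x : E) (A.op x)).re)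
    (hAB : A.StronglyCommute B) :
    ∃ (ρ S : E →L[ℂ] E) (hρ : A.IsSqrtResolvent ρ) (k : ℝ → E →L[ℂ] E),
      Represents hρ H k ∧ IsEvolutionData ρ S k C (A.relFormBound B hQ) := by
  obtain ⟨R, S, hR, hS, hRS⟩ := hAB
  have hρ := hR.isSqrtResolvent_sqrt
  obtain ⟨c, hc0, hc⟩ := exists_form_le_mul_form hρ hA hS.isSqrtResolvent_sqrt hQ
  have hβ := form_le_relFormBound_mul hQ hc0 hc
  have hβ0 := relFormBound_nonneg hQ
  obtain ⟨k, hk⟩ := hH.exists_represents hC hρ hβ0 hβ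
  exact ⟨CFC.sqrt R, S, hρ, k, hk, hk.isEvolutionData hC hA hS (commute_sqrt hRS) hH hβ0 hβ⟩

namespace Represents

variable {hρ : A.IsSqrtResolvent ρ} {β : ℝ}

theorem isSolution (hk : Represents hρ H k) (hkc : ContinuousOn k (Ico 0 1)) {w : ℝ → E}
    (hw : IsWeakEvolution ρ k w) {b : ℝ} (hb : ∀ t ∈ Ico (0 : ℝ) 1, defectForm ρ (w t) ≤ b) :
    A.IsSolution H (hρ.formDomainEquiv (w 0)) fun t => ρ (w t) where
  continuousOn := hw.continuousOn
  initial := rfl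
  equation := by
    refine ⟨fun t => hρ.formDomainEquiv (w t), Eventually.of_forall fun t => rfl, ⟨b, ?_⟩, ?_⟩
    · filter_upwards [ae_restrict_mem measurableSet_Ioo] with t ht
      exact hρ.form_formDomainEquiv (w t) ▸ hb t (Ioo_subset_Ico_self ht)
    · intro y φ hφ hφc hφs
      obtain ⟨v, rfl⟩ := hρ.formDomainEquiv.surjective y
      refine (hw.distributional hρ.isSelfAdjoint hρ.injective hkc hk.isSelfAdjoint v
        ⟨hφ, hφc, hφs⟩).trans ?_
      refine setIntegral_congr_fun measurableSet_Ioo fun t ht => ?_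
      simp only [hk.inner_apply t (Ioo_subset_Ico_self ht)]

theorem exists_isWeakEvolution (hk : Represents hρ H k) (D : IsEvolutionData ρ S k C β)
    {x₀ : A.formDomain} {x : ℝ → E} (hx : A.IsSolution H x₀ x) :
    ∃ w : ℝ → E, (∀ t ∈ Ico (0 : ℝ) 1, ρ (w t) = x t) ∧ IsWeakEvolution ρ k w := by
  obtain ⟨z, hzx, ⟨M, hM⟩, heq⟩ := hx.equation
  obtain ⟨L, hL⟩ := D.lipschitz
  set ζ : ℝ → E := fun t => hρ.formDomainEquiv.symm (z t)
  have hζ : ∀ t, hρ.formDomainEquiv (ζ t) = z t := fun t => LinearEquiv.apply_symm_apply _ _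
  refine exists_isWeakEvolution_of_distributional_ae hρ.isSelfAdjoint hρ.injective hL.continuousOn
    hk.isSelfAdjoint (ζ := ζ) (M := √(2 * M)) hx.continuousOn ?_ ?_ fun y φ hφ => ?_
  · filter_upwards [hzx] with t ht
    rw [← ht, ← hζ, hρ.coe_formDomainEquiv]
  · filter_upwards [hM] with t ht
    refine Real.le_sqrt_of_sq_le ((D.norm_sq_le_two_mul _).trans ?_)
    rw [← hρ.form_formDomainEquiv, hζ]
    gcongr
  · have h := heq (hρ.formDomainEquiv y) φ hφ.contDiff hφ.hasCompactSupport hφ.tsupport_subset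
    simp only [← hζ, hρ.coe_formDomainEquiv] at h
    rw [h]
    refine setIntegral_congr_fun measurableSet_Ioo fun t ht => ?_
    simp only [hk.inner_apply t (Ioo_subset_Ico_self ht)]

theorem exists_isSolution (hk : Represents hρ H k) (D : IsEvolutionData ρ S k C β)
    (x₀ : A.formDomain) :
    ∃ w, A.IsSolution H x₀ (fun t => ρ (w t)) ∧ IsWeakEvolution ρ k w ∧
      ∀ t ∈ Ico (0 : ℝ) 1, defectForm ρ (w t) ≤
        C * (C + C * β) * Real.exp ((C ^ 2 + C ^ 3) * t) * A.form x₀ := by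
  obtain ⟨w₀, rfl⟩ := hρ.formDomainEquiv.surjective x₀
  obtain ⟨w, rfl, hw, hbound⟩ := D.exists_isWeakEvolution w₀
  obtain ⟨L, hL⟩ := D.lipschitz
  have hC := D.pos
  have hβ := D.bound_nonneg
  have hw₀ := D.defectForm_nonneg (w 0)
  refine ⟨w, hk.isSolution hL.continuousOn hw (b := C * (C + C * β) * Real.exp (C ^ 2 + C ^ 3) *
    defectForm ρ (w 0)) fun t ht => ?_, hw, by rwa [hρ.form_formDomainEquiv]⟩
  grw [hbound t ht, mul_le_of_le_one_right (by positivity) ht.2.le]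

theorem eqOn_of_isSolution (hk : Represents hρ H k) (D : IsEvolutionData ρ S k C β)
    {x₀ : A.formDomain} {x y : ℝ → E} (hx : A.IsSolution H x₀ x) (hy : A.IsSolution H x₀ y) :
    EqOn x y (Ico 0 1) := by
  obtain ⟨w, hwx, hw⟩ := hk.exists_isWeakEvolution D hx
  obtain ⟨v, hvy, hv⟩ := hk.exists_isWeakEvolution D hy
  have hzero : (0 : ℝ) ∈ Ico (0 : ℝ) 1 := left_mem_Ico.mpr zero_lt_one
  have hinitial : ρ (w 0) = ρ (v 0) := by
    rw [hwx 0 hzero, hvy 0 hzero, hx.initial, hy.initial]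
  intro t ht
  rw [← hwx t ht, ← hvy t ht]
  exact hw.eq_of_initial hv hρ.isSelfAdjoint hk.isSelfAdjoint hinitial ht

end Represents

end PosSelfAdjoint

end FormFamily

/-- The growth constant as a function of the relative form bound `β`. It dominates both the
prefactor `C (C + C β)` and the rate `C² + C³` of the energy estimate; the absolute value makes it
positive for every real `β`. -/
noncomputable def growthConstant (C β : ℝ) : ℝ := 1 + C * (C + C * |β|) + (C ^ 2 + C ^ 3)

theorem growthConstant_pos {C : ℝ} (hC : 0 < C) (β : ℝ) : 0 < growthConstant C β := by
  unfold growthConstant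
  positivity

theorem mul_exp_mul_le_growthConstant {C β a t : ℝ} (hC : 0 < C) (ha : 0 ≤ a) (ht : 0 ≤ t) :
    C * (C + C * β) * Real.exp ((C ^ 2 + C ^ 3) * t) * a ≤
      growthConstant C β * Real.exp (growthConstant C β * t) * (a + growthConstant C β) := by
  have hK := growthConstant_pos hC β
  have hprefactor : C * (C + C * β) ≤ growthConstant C β := by
    grw [le_abs_self β, growthConstant]
    nlinarith [pow_pos hC 2, pow_pos hC 3]
  have hrate : C ^ 2 + C ^ 3 ≤ growthConstant C β := by
    have : 0 ≤ C * (C + C * |β|) := by positivity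
    unfold growthConstant
    linarith
  calc C * (C + C * β) * Real.exp ((C ^ 2 + C ^ 3) * t) * a
      ≤ growthConstant C β * Real.exp (growthConstant C β * t) * a := by gcongr
    _ ≤ _ := by gcongr; linarith

theorem mainTheorem5 (C : ℝ) (hC : 0 < C) :
    ∃ K : ℝ → ℝ, (∀ β, 0 < K β) ∧
      ∀ {E : Type*} [NormedAddCommGroup E] [InnerProductSpace ℂ E] [CompleteSpace E]
        (A B : PosSelfAdjoint E)
        (H : ℝ → A.formDomain →ₗ⋆[ℂ] A.formDomain →ₗ[ℂ] ℂ)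
        -- `A ≥ 1`
        (_ : ∀ x : A.op.domain, ‖(x : E)‖ ^ 2 ≤ (inner ℂ (x : E) (A.op x)).re)
        -- the forms `H(t)` are symmetric
        (_ : ∀ t ∈ Ico (0 : ℝ) 1, ∀ x y : A.formDomain, H t x y = conj (H t y x))
        -- `B` commutes with `A`, and its form is defined on `Q(A)`
        (_ : A.StronglyCommute B)
        (hQ : A.formDomain ≤ B.formDomain)
        -- `H(t) ≤ C A`
        (_ : ∀ t ∈ Ico (0 : ℝ) 1, ∀ x : A.formDomain, (H t x x).re ≤ C * A.form x)
        -- `C⁻¹ A - C B ≤ H(t)`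
        (_ : ∀ t ∈ Ico (0 : ℝ) 1, ∀ x : A.formDomain,
          C⁻¹ * A.form x - C * B.form (Submodule.inclusion hQ x) ≤ (H t x x).re)
        -- `i [H(t), B] ≤ C A`
        (_ : ∀ t ∈ Ico (0 : ℝ) 1, ∀ (x : A.formDomain) (hx : (x : E) ∈ B.op.domain)
          (hBx : B.op ⟨x, hx⟩ ∈ A.formDomain),
          (Complex.I * (H t x ⟨B.op ⟨x, hx⟩, hBx⟩ - H t ⟨B.op ⟨x, hx⟩, hBx⟩ x)).re ≤
            C * A.form x)
        -- `H(t)` has a time derivative, and `± Ḣ(t) ≤ C A`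
        (_ : ∀ t ∈ Ico (0 : ℝ) 1, ∀ x : A.formDomain, ∃ d : ℝ,
          HasDerivWithinAt (fun s => (H s x x).re) d (Ico 0 1) t ∧
            -(C * A.form x) ≤ d ∧ d ≤ C * A.form x)
        (x₀ : A.formDomain),
        ∃ x : ℝ → E, A.IsSolution H x₀ x ∧
          (∀ x' : ℝ → E, A.IsSolution H x₀ x' → EqOn x' x (Ico 0 1)) ∧
          ∀ t ∈ Ico (0 : ℝ) 1, ‖x t‖ = ‖(x₀ : E)‖ ∧
            ∃ hx : x t ∈ A.formDomain,
              A.form ⟨x t, hx⟩ ≤ K (A.relFormBound B hQ) *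
                Real.exp (K (A.relFormBound B hQ) * t) *
                  (A.form x₀ + K (A.relFormBound B hQ)) := by
  refine ⟨growthConstant C, growthConstant_pos hC, ?_⟩
  intro E _ _ _ A B H hA hsymm hcomm hQ hupper hlower hcommutator hderiv x₀
  have hH : A.IsControlledFamily B hQ H C := ⟨hsymm, hupper, hlower, hcommutator, hderiv⟩
  obtain ⟨ρ, S, hρ, k, hk, D⟩ := hH.exists_isEvolutionData hC hA hcomm
  obtain ⟨w, hsol, hw, hbound⟩ := hk.exists_isSolution D x₀
  refine ⟨fun t => ρ (w t), hsol, fun x' hx' => hk.eqOn_of_isSolution D hx' hsol,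
    fun t ht => ⟨?_, hρ.apply_mem_formDomain _, ?_⟩⟩
  · rw [← hsol.initial]
    exact hw.norm_eq hρ.isSelfAdjoint hk.isSelfAdjoint ht
  · rw [hρ.form_apply]
    exact (hbound t ht).trans (mul_exp_mul_le_growthConstant hC (A.form_nonneg x₀) ht.1)
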